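/- Graphs are finite, connected, simple and undirected. For a finite group $G$, a subgroup $H\le G$ and a union $D=D^{-1}$ of double cosets of $H$ in $G$, the coset graph $\mathrm{Cos}(G,H,D)$ has as vertices the right cosets of $H$ in $G$ and as edges the pairs $\{Hg,Hdg\}$ with $g\in G$, $d\in D$. Permutations are written as products of disjoint cycles on the points $1,\dots,8$. Let $S_5$ and $A_5$ be the symmetric and the alternating group on $\{1,\dots,5\}$, let $\mathbb Z_2=\langle(6\;7)\rangle$, and let $\mathrm{PGL}(2,7)$ act on $\{1,\dots,8\}$ by Möbius transformations of the projective line over $\mathbb F_7$, where the labels $1,2,3,4,5,6,7,8$ stand for $1,2,4,0,3,5,6,\infty$, respectively. For $0\le i\le 8$ let $\mathrm{NC}^i=\mathrm{Cos}(G,H,HaH\cup HbH)$, where $G,H,a,b$ are as follows. - $\mathrm{NC}_{60}^0$: $G=S_5$, $H=\langle(1\,3)(2\,5)\rangle$, $a=(1\,2\,4\,5\,3)$, $b=(2\,5)$. - $\mathrm{NC}_{60}^1$: $G=A_5\times\mathbb Z_2$, $H=\langle(2\,3)(4\,5)\rangle$, $a=(2\,5)(3\,4)(6\,7)$, $b=(1\,2)(3\,4)(6\,7)$.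 - $\mathrm{NC}_{60}^2$: $G=A_5\times\mathbb Z_2$, $H=\langle(2\,3)(4\,5)\rangle$, $a=(1\,2\,4\,5\,3)$, $b=(2\,4)(3\,5)(6\,7)$. - $\mathrm{NC}_{60}^3$: $G=A_5\times\mathbb Z_2$, $H=\langle(2\,3)(4\,5)\rangle$, $a=(1\,3\,5\,4\,2)(6\,7)$, $b=(2\,4)(3\,5)$. - $\mathrm{NC}_{60}^4$: $G=S_5\times\mathbb Z_2$, $H=\langle(1\,3),(4\,5)\rangle$, $a=(1\,3\,2)(4\,5)$, $b=(1\,5\,3\,4)(6\,7)$. - $\mathrm{NC}_{60}^5$: $G=S_5\times\mathbb Z_2$, $H=\langle(1\,3)(6\,7),(4\,5)(6\,7)\rangle$, $a=(2\,5)$, $b=(1\,4\,3\,5)(6\,7)$. - $\mathrm{NC}_{60}^6$: $G=S_5\times\mathbb Z_2$, $H=\langle(1\,3)(6\,7),(4\,5)(6\,7)\rangle$, $a=(2\,4)$, $b=(1\,4)(3\,5)(6\,7)$. - $\mathrm{NC}_{84}^7$: $G=\mathrm{PGL}(2,7)$, $H=\langle(1\,7)(2\,4)(3\,8),(1\,4)(2\,7)(5\,6)\rangle$,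 $a=(1\,8\,4)(2\,7\,3)$, $b=(1\,4\,2\,7)(3\,6\,8\,5)$. - $\mathrm{NC}_{84}^8$: $G=\mathrm{PGL}(2,7)$, $H=\langle(1\,6)(2\,4)(3\,7)(5\,8),(1\,4)(2\,6)(3\,8)(5\,7)\rangle$, $a=(1\,3\,5\,2\,6\,7\,8\,4)$, $b=(1\,5\,2\,3)(4\,8\,6\,7)$. **Theorem 4.1.** These nine graphs are pairwise non-isomorphic. The graphs $\mathrm{NC}_{60}^0,\dots,\mathrm{NC}_{60}^6$ have $60$ vertices, and $\mathrm{NC}_{84}^7,\mathrm{NC}_{84}^8$ have $84$ vertices. Each of the nine graphs is connected and cubic; its full automorphism group is transitive on the vertices, is not transitive on the arcs (ordered pairs of adjacent vertices), and is not solvable; and the graph is not isomorphic to a Cayley graph. -/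

import Mathlib

open Equiv

namespace CubicVNC

/-! ### Graph notions -/

section Graphs

universe u

variable {V : Type u}

/-- Every vertex has exactly three neighbours. -/
def IsCubic (X : SimpleGraph V) : Prop :=
  ∀ v : V, (X.neighborSet v).ncard = 3

/-- The full automorphism group is transitive on the vertices. -/
def IsVertexTransitive (X : SimpleGraph V) : Prop :=
  ∀ u v : V, ∃ f : X ≃g X, f u = v

/-- The full automorphism group is transitive on the arcs (ordered pairs of adjacent vertices);
such a graph is also called symmetric. -/
def IsArcTransitive (X : SimpleGraph V) : Prop :=
  ∀ u v u' v' : V, X.Adj u v → X.Adj u' v' → ∃ f : X ≃g X, f u = u' ∧ f v = v'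

/-- `X` is isomorphic to a Cayley graph of a group `Γ` with respect to an inverse-closed set `S`
not containing the identity. Mathlib's `SimpleGraph.mulCayley` joins `g` to `g * s`; inversion
of `Γ` is an isomorphism onto the graph that joins `g` to `s * g`. -/
def IsCayley (X : SimpleGraph V) : Prop :=
  ∃ (Γ : Type u) (_ : Group Γ) (S : Set Γ),
    (1 : Γ) ∉ S ∧ (∀ s ∈ S, s⁻¹ ∈ S) ∧ Nonempty (X ≃g SimpleGraph.mulCayley S)

/-- Vertex-transitive non-Cayley graphs; graphs are finite, connected, simple and undirected. -/
def IsVNC (X : SimpleGraph V) : Prop :=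
  Finite V ∧ X.Connected ∧ IsVertexTransitive X ∧ ¬ IsCayley X

end Graphs

/-- The coset graph `Cos(G, H, D)`: its vertices are the right cosets `Hg` of `H` in `G`, its edges
are the pairs `{Hg, Hdg}` with `g ∈ G` and `d ∈ D`. -/
def cosetGraph {G : Type*} [Group G] (H : Subgroup G) (D : Set G) :
    SimpleGraph (Quotient (QuotientGroup.rightRel H)) :=
  SimpleGraph.fromRel fun x y =>
    ∃ g : G, ∃ d ∈ D, x = Quotient.mk (QuotientGroup.rightRel H) g ∧
      y = Quotient.mk (QuotientGroup.rightRel H) (d * g)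

/-! ### The groups

All groups are permutation groups on the points `1, …, 8`, realised as the elements of `Fin 8`;
the numeral `8` denotes the element `0` of `Fin 8`, so that the labels `1, …, 8` can be used
literally. A permutation such as `(1 4)(2 7)(5 6)` is a product of disjoint cycles. -/

/-- `S₅`, the symmetric group on the points `1, …, 5`. -/
def S5 : Subgroup (Perm (Fin 8)) := fixingSubgroup (Perm (Fin 8)) ({6, 7, 8} : Set (Fin 8))

/-- `A₅`, the alternating group on the points `1, …, 5`. -/
def A5 : Subgroup (Perm (Fin 8)) := S5 ⊓ alternatingGroup (Fin 8)

/-- `ℤ₂`, generated by the transposition `(6 7)`. -/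
def Z2 : Subgroup (Perm (Fin 8)) := Subgroup.zpowers c[6, 7]

/-- `S₅ × ℤ₂`, as an internal direct product. -/
def S5Z2 : Subgroup (Perm (Fin 8)) := S5 ⊔ Z2

/-- `A₅ × ℤ₂`, as an internal direct product. -/
def A5Z2 : Subgroup (Perm (Fin 8)) := A5 ⊔ Z2

instance fact_prime_seven : Fact (Nat.Prime 7) := ⟨by norm_num⟩

instance decEqOnePoint : DecidableEq (OnePoint (ZMod 7)) :=
  inferInstanceAs (DecidableEq (Option (ZMod 7)))

/-- A labelling of the projective line over `𝔽₇` by the points `1, …, 8`: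
the labels `1, 2, 3, 4, 5, 6, 7, 8` denote `1, 2, 4, 0, 3, 5, 6, ∞`
(the vector below starts with the label `8 = 0`). -/
def label (k : Fin 8) : OnePoint (ZMod 7) :=
  (![OnePoint.infty, ((1 : ZMod 7) : OnePoint (ZMod 7)), ((2 : ZMod 7) : OnePoint (ZMod 7)),
    ((4 : ZMod 7) : OnePoint (ZMod 7)), ((0 : ZMod 7) : OnePoint (ZMod 7)),
    ((3 : ZMod 7) : OnePoint (ZMod 7)), ((5 : ZMod 7) : OnePoint (ZMod 7)),
    ((6 : ZMod 7) : OnePoint (ZMod 7))] : Fin 8 → OnePoint (ZMod 7)) k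

/-- `PGL(2,7)` as a permutation group of degree 8: the permutations of the labels that are induced
by the action of `GL(2,7)` on the projective line by Möbius transformations. -/
def PGL27 : Subgroup (Perm (Fin 8)) where
  carrier := {σ | ∃ M : GL (Fin 2) (ZMod 7), ∀ k, label (σ k) = M • label k}
  one_mem' := ⟨1, fun k => by simp⟩
  mul_mem' := by
    rintro σ τ ⟨M, hM⟩ ⟨N, hN⟩
    exact ⟨M * N, fun k => by rw [Perm.mul_apply, hM, hN, mul_smul]⟩
  inv_mem' := by
    rintro σ ⟨M, hM⟩
    refine ⟨M⁻¹, fun k => ?_⟩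
    rw [eq_inv_smul_iff, ← hM]
    exact congrArg label (σ.apply_symm_apply k)

/-! ### Membership of the listed permutations in their groups -/

theorem mem_S5 {σ : Perm (Fin 8)} (h : σ 6 = 6 ∧ σ 7 = 7 ∧ σ 8 = 8) : σ ∈ S5 := by
  rw [S5, mem_fixingSubgroup_iff]
  rintro y (rfl | rfl | rfl)
  exacts [h.1, h.2.1, h.2.2]

theorem mem_A5 {σ : Perm (Fin 8)} (h : σ 6 = 6 ∧ σ 7 = 7 ∧ σ 8 = 8) (hs : Perm.sign σ = 1) :
    σ ∈ A5 :=
  ⟨mem_S5 h, Perm.mem_alternatingGroup.2 hs⟩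

theorem mem_S5Z2 {σ : Perm (Fin 8)} (h : σ 6 = 6 ∧ σ 7 = 7 ∧ σ 8 = 8) : σ ∈ S5Z2 :=
  Subgroup.mem_sup_left (mem_S5 h)

theorem mul_mem_S5Z2 {σ : Perm (Fin 8)} (h : σ 6 = 6 ∧ σ 7 = 7 ∧ σ 8 = 8) :
    σ * c[6, 7] ∈ S5Z2 :=
  Subgroup.mul_mem_sup (mem_S5 h) (Subgroup.mem_zpowers _)

theorem mem_A5Z2 {σ : Perm (Fin 8)} (h : σ 6 = 6 ∧ σ 7 = 7 ∧ σ 8 = 8)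
    (hs : Perm.sign σ = 1) : σ ∈ A5Z2 :=
  Subgroup.mem_sup_left (mem_A5 h hs)

theorem mul_mem_A5Z2 {σ : Perm (Fin 8)} (h : σ 6 = 6 ∧ σ 7 = 7 ∧ σ 8 = 8)
    (hs : Perm.sign σ = 1) : σ * c[6, 7] ∈ A5Z2 :=
  Subgroup.mul_mem_sup (mem_A5 h hs) (Subgroup.mem_zpowers _)

theorem inv_eq_pow_five (y : ZMod 7) : y⁻¹ = y ^ 5 := by
  rcases eq_or_ne y 0 with rfl | hy
  · simp
  · refine inv_eq_of_mul_eq_one_right ?_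
    rw [← pow_succ']
    exact ZMod.pow_card_sub_one_eq_one hy

/-- The Möbius transformation `x ↦ (p x + q) / (r x + s)` over `𝔽₇`, where `y⁻¹ = y ^ 5`. -/
def moebius (p q r s : ZMod 7) (x : OnePoint (ZMod 7)) : OnePoint (ZMod 7) :=
  x.elim (if r = 0 then OnePoint.infty else ((p * r ^ 5 : ZMod 7) : OnePoint (ZMod 7)))
    (fun t => if r * t + s = 0 then OnePoint.infty else
      (((p * t + q) * (r * t + s) ^ 5 : ZMod 7) : OnePoint (ZMod 7)))

theorem mem_PGL27 {σ : Perm (Fin 8)} (p q r s : ZMod 7) (hd : p * s - q * r ≠ 0)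
    (h : ∀ k, label (σ k) = moebius p q r s (label k)) : σ ∈ PGL27 := by
  refine ⟨Matrix.GeneralLinearGroup.mkOfDetNeZero !![p, q; r, s]
    (by rwa [Matrix.det_fin_two_of]), fun k => ?_⟩
  rw [h k]
  generalize label k = x
  cases x with
  | infty =>
    simp [moebius, OnePoint.smul_infty_eq_ite, Matrix.GeneralLinearGroup.mkOfDetNeZero,
      div_eq_mul_inv, inv_eq_pow_five]
  | coe t =>
    simp [moebius, OnePoint.smul_some_eq_ite, Matrix.GeneralLinearGroup.mkOfDetNeZero,
      div_eq_mul_inv, inv_eq_pow_five]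

/-! ### The nine graphs -/

/-- A group `G`, a subgroup `H` of `G` and two elements `a`, `b` of `G`. -/
structure CosetDatum where
  G : Subgroup (Perm (Fin 8))
  H : Subgroup (Perm (Fin 8))
  a : Perm (Fin 8)
  b : Perm (Fin 8)
  H_le : H ≤ G
  a_mem : a ∈ G
  b_mem : b ∈ G

namespace CosetDatum

/-- `H` as a subgroup of the group `G`. -/
abbrev subgroup (d : CosetDatum) : Subgroup d.G := d.H.subgroupOf d.G

/-- The union `HaH ∪ HbH` of two double cosets in `G`. -/
def connectionSet (d : CosetDatum) : Set d.G :=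
  DoubleCoset.doubleCoset ⟨d.a, d.a_mem⟩ (d.subgroup : Set d.G) (d.subgroup : Set d.G) ∪
    DoubleCoset.doubleCoset ⟨d.b, d.b_mem⟩ (d.subgroup : Set d.G) (d.subgroup : Set d.G)

/-- The vertices of the coset graph: the right cosets of `H` in `G`. -/
abbrev Vertex (d : CosetDatum) : Type := Quotient (QuotientGroup.rightRel d.subgroup)

/-- The coset graph `Cos(G, H, HaH ∪ HbH)`. -/
def graph (d : CosetDatum) : SimpleGraph d.Vertex := cosetGraph d.subgroup d.connectionSet

end CosetDatum

theorem closure_pair_le {G : Subgroup (Perm (Fin 8))} {x y : Perm (Fin 8)}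
    (hx : x ∈ G) (hy : y ∈ G) : Subgroup.closure {x, y} ≤ G := by
  rw [Subgroup.closure_le]
  rintro z (rfl | rfl)
  exacts [hx, hy]

theorem closure_single_le {G : Subgroup (Perm (Fin 8))} {x : Perm (Fin 8)}
    (hx : x ∈ G) : Subgroup.closure {x} ≤ G := by
  rw [Subgroup.closure_le]
  rintro z rfl
  exact hx

def row0 : CosetDatum where
  G := S5
  H := Subgroup.closure {c[1, 3] * c[2, 5]}
  a := c[1, 2, 4, 5, 3]
  b := c[2, 5]
  H_le := closure_single_le (mem_S5 (by decide))
  a_mem := mem_S5 (by decide)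
  b_mem := mem_S5 (by decide)

def row1 : CosetDatum where
  G := A5Z2
  H := Subgroup.closure {c[2, 3] * c[4, 5]}
  a := c[2, 5] * c[3, 4] * c[6, 7]
  b := c[1, 2] * c[3, 4] * c[6, 7]
  H_le := closure_single_le (mem_A5Z2 (by decide) (by decide))
  a_mem := mul_mem_A5Z2 (by decide) (by decide)
  b_mem := mul_mem_A5Z2 (by decide) (by decide)

def row2 : CosetDatum where
  G := A5Z2
  H := Subgroup.closure {c[2, 3] * c[4, 5]}
  a := c[1, 2, 4, 5, 3]
  b := c[2, 4] * c[3, 5] * c[6, 7]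
  H_le := closure_single_le (mem_A5Z2 (by decide) (by decide))
  a_mem := mem_A5Z2 (by decide) (by decide)
  b_mem := mul_mem_A5Z2 (by decide) (by decide)

def row3 : CosetDatum where
  G := A5Z2
  H := Subgroup.closure {c[2, 3] * c[4, 5]}
  a := c[1, 3, 5, 4, 2] * c[6, 7]
  b := c[2, 4] * c[3, 5]
  H_le := closure_single_le (mem_A5Z2 (by decide) (by decide))
  a_mem := mul_mem_A5Z2 (by decide) (by decide)
  b_mem := mem_A5Z2 (by decide) (by decide)

def row4 : CosetDatum where
  G := S5Z2
  H := Subgroup.closure {c[1, 3], c[4, 5]}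
  a := c[1, 3, 2] * c[4, 5]
  b := c[1, 5, 3, 4] * c[6, 7]
  H_le := closure_pair_le (mem_S5Z2 (by decide)) (mem_S5Z2 (by decide))
  a_mem := mem_S5Z2 (by decide)
  b_mem := mul_mem_S5Z2 (by decide)

def row5 : CosetDatum where
  G := S5Z2
  H := Subgroup.closure {c[1, 3] * c[6, 7], c[4, 5] * c[6, 7]}
  a := c[2, 5]
  b := c[1, 4, 3, 5] * c[6, 7]
  H_le := closure_pair_le (mul_mem_S5Z2 (by decide)) (mul_mem_S5Z2 (by decide))
  a_mem := mem_S5Z2 (by decide)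
  b_mem := mul_mem_S5Z2 (by decide)

def row6 : CosetDatum where
  G := S5Z2
  H := Subgroup.closure {c[1, 3] * c[6, 7], c[4, 5] * c[6, 7]}
  a := c[2, 4]
  b := c[1, 4] * c[3, 5] * c[6, 7]
  H_le := closure_pair_le (mul_mem_S5Z2 (by decide)) (mul_mem_S5Z2 (by decide))
  a_mem := mem_S5Z2 (by decide)
  b_mem := mul_mem_S5Z2 (by decide)

def row7 : CosetDatum where
  G := PGL27
  H := Subgroup.closure {c[1, 7] * c[2, 4] * c[3, 8], c[1, 4] * c[2, 7] * c[5, 6]}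
  a := c[1, 8, 4] * c[2, 7, 3]
  b := c[1, 4, 2, 7] * c[3, 6, 8, 5]
  H_le := closure_pair_le (mem_PGL27 1 5 2 6 (by decide) (by decide))
    (mem_PGL27 1 6 0 6 (by decide) (by decide))
  a_mem := mem_PGL27 0 1 6 1 (by decide) (by decide)
  b_mem := mem_PGL27 1 6 5 3 (by decide) (by decide)

def row8 : CosetDatum where
  G := PGL27
  H := Subgroup.closure
    {c[1, 6] * c[2, 4] * c[3, 7] * c[5, 8], c[1, 4] * c[2, 6] * c[3, 8] * c[5, 7]}
  a := c[1, 3, 5, 2, 6, 7, 8, 4]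
  b := c[1, 5, 2, 3] * c[4, 8, 6, 7]
  H_le := closure_pair_le (mem_PGL27 1 5 5 6 (by decide) (by decide))
    (mem_PGL27 1 6 2 6 (by decide) (by decide))
  a_mem := mem_PGL27 0 1 1 1 (by decide) (by decide)
  b_mem := mem_PGL27 1 1 3 0 (by decide) (by decide)

/-- The data `(G, H, a, b)` of the nine graphs. -/
def row : Fin 9 → CosetDatum :=
  ![row0, row1, row2, row3, row4, row5, row6, row7, row8]

/-- The graph `NC^i`, for `0 ≤ i ≤ 8`. -/
def NC (i : Fin 9) : SimpleGraph (row i).Vertex := (row i).graph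

end CubicVNC

/-! Each group G acts on its coset graph by right multiplication, so vertex-transitivity is
automatic. The heart of the proof is that this action yields every automorphism
(`cosetAction_surjective`), and colour refinement shows it. Automorphisms respect refined colours
(`colour_iso`). When the vertex H is singled out, all vertices with the colour of a chosen vertex
`base` lie in its H-orbit; when H and `base` are both singled out, all colours differ. An arbitrary
automorphism, corrected by an element of G so as to fix H and then by an element of H so as to fix
`base`, is therefore the identity.

In a Cayley graph any vertex is carried to any other by an automorphism whose nontrivial powers fix
no vertex (`IsCayley.exists_regular`). For H and a suitable vertex `x` the candidates in G come from
the |H| elements of one coset, and each of them, or its square, fixes some vertex but not all.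
Arc-transitivity fails because two neighbours of H get different colours. Solvability fails because
some element with nontrivial image is the commutator of two of its own conjugates. Finally, the sum
of the squared colours does not depend on the vertex singled out, by transitivity, and its nine
values differ.

All this is reduced to arithmetic on tables: `Table.Valid` is a finite check, and `Table.Models`
ties a table to its group. Only an upper bound on |G| is needed there, since the distinct products
in the table give the lower bound. -/

namespace CubicVNC

/-! ### Colour refinement -/

section Colour

variable {V W : Type*}

/-- `k` rounds of (hashed) colour refinement of an initial colouring of the vertices. -/
noncomputable def colour (X : SimpleGraph V) (c : V → ℕ) : ℕ → V → ℕ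
  | 0 => c
  | k + 1 => fun v => (3 * colour X c k v + ∑ᶠ w ∈ X.neighborSet v, (colour X c k w + 5) ^ 2)
      % 1000003

/-- An isomorphism matches neighbourhoods, so each round of refinement commutes with it. Only this
direction is ever used: a collision of the hash could lose information but never falsify a
conclusion, so the constants of the hash are arbitrary. -/
theorem colour_iso {X : SimpleGraph V} {Y : SimpleGraph W} (f : X ≃g Y) {c : V → ℕ} {d : W → ℕ}
    (h : ∀ v, d (f v) = c v) (k : ℕ) (v : V) : colour Y d k (f v) = colour X c k v := by
  induction k generalizing v with
  | zero => exact h v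
  | succ k ih =>
    simp only [colour]
    rw [ih v]
    congr 2
    refine (finsum_mem_eq_of_bijOn f ⟨?_, f.injective.injOn, ?_⟩ ?_).symm
    · intro w hw
      exact f.map_adj_iff.2 hw
    · intro w hw
      refine ⟨f.symm w, ?_, f.apply_symm_apply w⟩
      have hw' : Y.Adj (f v) w := hw
      rw [← f.apply_symm_apply w, f.map_adj_iff] at hw'
      exact hw'
    · intro w _
      rw [ih w]

open Classical in
/-- The initial colouring that singles out one vertex. -/
noncomputable def pointColour (v : V) : V → ℕ := fun u => if u = v then 1 else 0

open Classical in
/-- The initial colouring that singles out two vertices. -/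
noncomputable def pairColour (v w : V) : V → ℕ :=
  fun u => if u = v then 1 else if u = w then 2 else 0

theorem colour_point_iso {X : SimpleGraph V} {Y : SimpleGraph W} (f : X ≃g Y) (v u : V) (k : ℕ) :
    colour Y (pointColour (f v)) k (f u) = colour X (pointColour v) k u :=
  colour_iso f (fun _ => by classical exact if_congr f.injective.eq_iff rfl rfl) k u

theorem iso_eq_of_colour_pair_injective {X : SimpleGraph V} {v w : V} {k : ℕ}
    (hinj : Function.Injective (colour X (pairColour v w) k)) (f : X ≃g X) (hv : f v = v)
    (hw : f w = w) : f = 1 := by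
  ext u
  refine hinj (colour_iso f (fun u => ?_) k u)
  have h1 : f u = v ↔ u = v := by
    rw [← f.injective.eq_iff (a := u), hv]
  have h2 : f u = w ↔ u = w := by
    rw [← f.injective.eq_iff (a := u), hw]
  classical exact if_congr h1 rfl (if_congr h2 rfl rfl)

/-- A numerical invariant of the pointed graph `(X, v)`. -/
noncomputable def pointHash (X : SimpleGraph V) (k : ℕ) (v : V) : ℕ :=
  ∑ᶠ u, colour X (pointColour v) k u ^ 2

theorem pointHash_iso {X : SimpleGraph V} {Y : SimpleGraph W} (f : X ≃g Y) (k : ℕ) (v : V) :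
    pointHash Y k (f v) = pointHash X k v := by
  unfold pointHash
  rw [← finsum_comp_equiv f.toEquiv]
  exact finsum_congr fun u => congrArg (· ^ 2) (colour_point_iso f v u k)

end Colour

/-! ### Cayley graphs -/

/-- Left multiplications are automorphisms of a graph that joins g to gs, and they act regularly.
All that is kept of this regular action is one element taking `u` to `v` whose powers are trivial or
fixed-point-free. -/
theorem IsCayley.exists_regular {V : Type*} {X : SimpleGraph V} (h : IsCayley X) (u v : V) :
    ∃ f : X ≃g X, f u = v ∧ ∀ k : ℕ, ∀ w, (f ^ k) w = w → f ^ k = 1 := by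
  obtain ⟨Γ, _, S, -, -, ⟨e⟩⟩ := h
  have hadj : ∀ s x y : Γ, (SimpleGraph.mulCayley S).Adj (s * x) (s * y) ↔
      (SimpleGraph.mulCayley S).Adj x y := by
    intro s x y
    simp [SimpleGraph.mulCayley_adj', mul_assoc]
  let L : Γ → (X ≃g X) := fun s =>
    e.trans (RelIso.trans ⟨Equiv.mulLeft s, hadj s _ _⟩ e.symm)
  have hL : ∀ s x, L s x = e.symm (s * e x) := fun s x => rfl
  have hpow : ∀ (s : Γ) (k : ℕ) x, (L s ^ k) x = e.symm (s ^ k * e x) := by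
    intro s k
    induction k with
    | zero => intro x; simp
    | succ k ih =>
      intro x
      rw [pow_succ, RelIso.mul_apply, ih, hL]
      simp [pow_succ, mul_assoc]
  refine ⟨L (e v * (e u)⁻¹), by simp [hL], fun k w hw => ?_⟩
  rw [hpow, RelIso.symm_apply_eq] at hw
  have : (e v * (e u)⁻¹) ^ k = 1 := by simpa using hw
  ext x
  rw [hpow, this]
  simp

/-! ### Solvability -/

-- The terms of the derived series are normal: if one contains x, it contains both conjugates, and
-- the next term contains their commutator x. So x never leaves the series.
open scoped commutatorElement in
theorem not_isSolvable_of_eq_commutator {G : Type*} [Group G] {x c d : G} (hx : x ≠ 1)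
    (h : x = ⁅c * x * c⁻¹, d * x * d⁻¹⁆) : ¬ Group.IsSolvable G := by
  refine not_isSolvable_of_mem_derivedSeries hx fun n => ?_
  induction n with
  | zero => trivial
  | succ n ih =>
    rw [h, derivedSeries_succ]
    exact Subgroup.commutator_mem_commutator ((derivedSeries_normal G n).conj_mem _ ih _)
      ((derivedSeries_normal G n).conj_mem _ ih _)

/-! ### Coset graphs -/

section CosetGraph

variable {G : Type*} [Group G] (H : Subgroup G) (D : Set G)

theorem mk_eq_mk_iff {x y : G} :
    Quotient.mk (QuotientGroup.rightRel H) x = Quotient.mk (QuotientGroup.rightRel H) y ↔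
      ∃ h ∈ H, x = h * y := by
  rw [Quotient.eq, QuotientGroup.rightRel_apply]
  constructor
  · intro h
    exact ⟨x * y⁻¹, by simpa using H.inv_mem h, by simp⟩
  · rintro ⟨h, hh, rfl⟩
    simpa using hh

/-- The permutation `Hy ↦ Hyg⁻¹` of the right cosets of `H`. -/
def cosetPerm (g : G) : Quotient (QuotientGroup.rightRel H) ≃
    Quotient (QuotientGroup.rightRel H) :=
  Quotient.congr (Equiv.mulRight g⁻¹) fun a b => by
    change QuotientGroup.rightRel H a b ↔ QuotientGroup.rightRel H (a * g⁻¹) (b * g⁻¹)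
    simp [QuotientGroup.rightRel_apply, mul_assoc]

@[simp]
theorem cosetPerm_mk (g y : G) : cosetPerm H g (Quotient.mk _ y) = Quotient.mk _ (y * g⁻¹) := rfl

/-- The action of `G` on a coset graph. -/
def cosetAction : G →* (cosetGraph H D ≃g cosetGraph H D) where
  toFun g := ⟨cosetPerm H g, by
    -- One implication for all g suffices; applying it to the inverse of g gives the converse.
    have key : ∀ (g : G) (x y : Quotient (QuotientGroup.rightRel H)),
        (∃ k : G, ∃ d ∈ D, x = Quotient.mk (QuotientGroup.rightRel H) k ∧
          y = Quotient.mk (QuotientGroup.rightRel H) (d * k)) →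
        ∃ k : G, ∃ d ∈ D, cosetPerm H g x = Quotient.mk (QuotientGroup.rightRel H) k ∧
          cosetPerm H g y = Quotient.mk (QuotientGroup.rightRel H) (d * k) := by
      rintro g _ _ ⟨k, d, hd, rfl, rfl⟩
      exact ⟨k * g⁻¹, d, hd, rfl, by simp [mul_assoc]⟩
    have hinv : ∀ x, cosetPerm H g⁻¹ (cosetPerm H g x) = x := by
      rintro ⟨x⟩
      change cosetPerm H g⁻¹ (cosetPerm H g (Quotient.mk _ x)) = Quotient.mk _ x
      simp
    have key' : ∀ (x y : Quotient (QuotientGroup.rightRel H)),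
        (∃ k : G, ∃ d ∈ D, cosetPerm H g x = Quotient.mk (QuotientGroup.rightRel H) k ∧
          cosetPerm H g y = Quotient.mk (QuotientGroup.rightRel H) (d * k)) ↔
        (∃ k : G, ∃ d ∈ D, x = Quotient.mk (QuotientGroup.rightRel H) k ∧
          y = Quotient.mk (QuotientGroup.rightRel H) (d * k)) :=
      fun x y => ⟨fun h => by simpa only [hinv] using key g⁻¹ _ _ h, key g x y⟩
    intro x y
    simp only [cosetGraph, SimpleGraph.fromRel_adj, key', ne_eq, EmbeddingLike.apply_eq_iff_eq]⟩
  map_one' := by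
    ext ⟨x⟩
    change cosetPerm H 1 (Quotient.mk _ x) = Quotient.mk _ x
    simp
  map_mul' g k := by
    ext ⟨x⟩
    change cosetPerm H (g * k) (Quotient.mk _ x) = cosetPerm H g (cosetPerm H k (Quotient.mk _ x))
    simp [mul_assoc]

@[simp]
theorem cosetAction_mk (g y : G) :
    cosetAction H D g (Quotient.mk _ y) = Quotient.mk _ (y * g⁻¹) := rfl

theorem isVertexTransitive_cosetGraph : IsVertexTransitive (cosetGraph H D) := by
  rintro ⟨x⟩ ⟨y⟩
  refine ⟨cosetAction H D (y⁻¹ * x), ?_⟩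
  change cosetAction H D (y⁻¹ * x) (Quotient.mk _ x) = Quotient.mk _ y
  rw [cosetAction_mk]
  simp

end CosetGraph

/-! ### Permutations of degree 8 as numbers in base 8 -/

/-- The digit of `8 ^ k` in `c`. -/
def digit (c k : ℕ) : ℕ := c / 8 ^ k % 8

/-- The number in base 8 with the given digits, the lowest one first. -/
def ofDigits (d : ℕ → ℕ) : ℕ :=
  d 0 + 8 * d 1 + 64 * d 2 + 512 * d 3 + 4096 * d 4 + 32768 * d 5 + 262144 * d 6 + 2097152 * d 7

/-- The composition of two permutations in terms of their codes. -/
def comp (c d : ℕ) : ℕ := ofDigits fun k => digit c (digit d k)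

/-- The code of a permutation: its values are the digits in base 8. -/
def code (σ : Perm (Fin 8)) : ℕ := ofDigits fun k => (σ (Fin.ofNat 8 k) : ℕ)

theorem digit_ofDigits {d : ℕ → ℕ} (hd : ∀ k, d k < 8) {k : ℕ} (hk : k < 8) :
    digit (ofDigits d) k = d k := by
  have h0 := hd 0
  have h1 := hd 1
  have h2 := hd 2
  have h3 := hd 3
  have h4 := hd 4
  have h5 := hd 5
  have h6 := hd 6
  have h7 := hd 7
  interval_cases k <;> simp only [digit, ofDigits] <;> omega

theorem digit_code (σ : Perm (Fin 8)) (k : Fin 8) : digit (code σ) k = σ k := by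
  rw [code, digit_ofDigits (fun _ => (σ _).isLt) k.isLt]
  congr 2
  exact Fin.ofNat_val_eq_self k

/-- Together with the injectivity of `code`, this turns every identity between permutations into
arithmetic of natural numbers. -/
theorem code_mul (σ τ : Perm (Fin 8)) : code (σ * τ) = comp (code σ) (code τ) := by
  have h : ∀ k < 8, digit (code σ) (digit (code τ) k) = ((σ * τ) (Fin.ofNat 8 k) : ℕ) := by
    intro k hk
    have := digit_code τ (Fin.ofNat 8 k)
    rw [Fin.val_ofNat, Nat.mod_eq_of_lt hk] at this
    rw [this, digit_code, Perm.mul_apply]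
  simp only [code, comp, ofDigits] at h ⊢
  rw [h 0, h 1, h 2, h 3, h 4, h 5, h 6, h 7] <;> norm_num

theorem code_injective : Function.Injective code := by
  intro σ τ h
  ext k
  rw [← digit_code, h, digit_code]

/-! ### Colour refinement on lists -/

/-- One round of colour refinement; `nb` lists the three neighbours of each vertex. -/
def colourStep (nb : List (ℕ × ℕ × ℕ)) (c : List ℕ) : List ℕ :=
  List.zipWith (fun t x => (3 * x + ((c.getD t.1 0 + 5) ^ 2 + ((c.getD t.2.1 0 + 5) ^ 2 +
    (c.getD t.2.2 0 + 5) ^ 2))) % 1000003) nb c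

/-- `k` rounds of colour refinement. -/
def colourList (nb : List (ℕ × ℕ × ℕ)) (c : List ℕ) : ℕ → List ℕ
  | 0 => c
  | k + 1 => colourStep nb (colourList nb c k)

theorem length_colourList {nb : List (ℕ × ℕ × ℕ)} {c : List ℕ} (h : c.length = nb.length)
    (k : ℕ) : (colourList nb c k).length = nb.length := by
  induction k with
  | zero => exact h
  | succ k ih => simp [colourList, colourStep, ih]

/-- `v` labels vertices of `X` by natural numbers in such a way that `nb` lists the neighbours. -/
def IsNeighbourTable {V : Type*} (X : SimpleGraph V) (v : ℕ → V) (nb : List (ℕ × ℕ × ℕ)) : Prop :=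
  ∀ i (hi : i < nb.length),
    X.neighborSet (v i) = {v nb[i].1, v nb[i].2.1, v nb[i].2.2} ∧
    v nb[i].1 ≠ v nb[i].2.1 ∧ v nb[i].1 ≠ v nb[i].2.2 ∧ v nb[i].2.1 ≠ v nb[i].2.2 ∧
    nb[i].1 < nb.length ∧ nb[i].2.1 < nb.length ∧ nb[i].2.2 < nb.length

/-- The three listed neighbours are distinct and make up the whole neighbourhood, so the sum over
the neighbour set has exactly the three terms of `colourStep`. The index bounds keep the default
value `0` out of play. -/
theorem IsNeighbourTable.getD_colourList {V : Type*} {X : SimpleGraph V} {v : ℕ → V}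
    {nb : List (ℕ × ℕ × ℕ)} (h : IsNeighbourTable X v nb) {c : List ℕ} (hc : c.length = nb.length)
    {c' : V → ℕ} (hcc : ∀ i < nb.length, c.getD i 0 = c' (v i)) (k : ℕ) {i : ℕ}
    (hi : i < nb.length) : (colourList nb c k).getD i 0 = colour X c' k (v i) := by
  induction k generalizing i with
  | zero => exact hcc i hi
  | succ k ih =>
    obtain ⟨hN, h12, h13, h23, l1, l2, l3⟩ := h i hi
    have hl := length_colourList hc k
    have hi' : i < (colourList nb c (k + 1)).length := by rwa [length_colourList hc]
    have ihi := ih hi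
    rw [List.getD_eq_getElem _ _ (by rwa [hl])] at ihi
    rw [List.getD_eq_getElem _ _ hi']
    simp only [colourList, colourStep, List.getElem_zipWith, colour]
    rw [hN, finsum_mem_insert _ (by simp [h12, h13]) (Set.toFinite _), finsum_mem_pair h23,
      ih l1, ih l2, ih l3, ihi]

/-- A membership test that reduces well in the kernel. -/
def memb (a : ℕ) : List ℕ → Bool := List.rec false fun b _ ih => cond (Nat.beq a b) true ih

/-- A test for duplicates that reduces well in the kernel. -/
def distinct : List ℕ → Bool := List.rec true fun b l ih => cond (memb b l) false ih

theorem memb_eq_true_iff {a : ℕ} {l : List ℕ} : memb a l = true ↔ a ∈ l := by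
  induction l with
  | nil => simp [memb]
  | cons b l ih =>
    rw [List.mem_cons, ← ih, ← Nat.beq_eq]
    change cond (Nat.beq a b) true (memb a l) = true ↔ _
    cases Nat.beq a b <;> simp

theorem nodup_of_distinct {l : List ℕ} (h : distinct l = true) : l.Nodup := by
  induction l with
  | nil => exact List.nodup_nil
  | cons b l ih =>
    change cond (memb b l) false (distinct l) = true at h
    rw [List.nodup_cons, ← memb_eq_true_iff]
    cases hb : memb b l <;> simp_all

/-! ### Tables that describe a coset graph -/

/-- A description of a coset graph by numbers: the codes `H` of the elements of the subgroup, the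
codes `A` and `B` of the two elements of the connection set, codes `R` of representatives of the
right cosets, the neighbours `nb` of each coset, and witnesses for the properties of the graph. -/
structure Table where
  H : List ℕ
  A : ℕ
  B : ℕ
  R : List ℕ
  nb : List (ℕ × ℕ × ℕ)
  -- `base` is the second vertex to be singled out, and `x` is the target vertex of the argument
  -- against Cayley graphs.
  base : ℕ
  x : ℕ
  hash : ℕ
  -- The representatives numbered p, q, r, c, d witness non-solvability: q and r are the conjugates
  -- of p by c and d, and p is the commutator of q and r.
  p : ℕ
  q : ℕ
  r : ℕ
  c : ℕ
  d : ℕ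

namespace Table

variable (T : Table)

/-- The number of vertices. -/
def n : ℕ := T.R.length

/-- The code of the `i`-th representative. -/
def rep (i : ℕ) : ℕ := T.R.getD i 0

/-- The neighbours of the `i`-th vertex. -/
def nbrs (i : ℕ) : List ℕ := [(T.nb.getD i 0).1, (T.nb.getD i 0).2.1, (T.nb.getD i 0).2.2]

/-- The colours of the vertices after individualization of vertex `0`. -/
def pointColours : List ℕ :=
  colourList T.nb ((List.range T.n).map fun i => if i = 0 then 1 else 0) 10

/-- The colours of the vertices after individualization of the vertices `0` and `base`. -/
def pairColours : List ℕ :=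
  colourList T.nb
    ((List.range T.n).map fun i => if i = 0 then 1 else if i = T.base then 2 else 0) 10

/-- The element with code `w` fixes the coset of the element with code `t`. -/
def Fixes (t w : ℕ) : Prop := ∃ k ∈ T.H, comp t w = comp k t

instance (t w : ℕ) : Decidable (T.Fixes t w) := inferInstanceAs (Decidable (∃ k ∈ T.H, _))

/-- The verifiable properties of the table of a vertex-transitive non-Cayley graph. -/
structure Valid : Prop where
  nodup : distinct (T.R.flatMap fun r => T.H.map fun h => comp h r) = true
  pos : 0 < T.n
  rep_zero : T.rep 0 = code 1
  length_nb : T.nb.length = T.n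
  -- A spanning tree rooted at `0`. It serves twice: for connectedness, and to show that every
  -- listed representative lies in G.
  reach : ∀ i < T.n, i = 0 ∨ ∃ j ∈ T.nbrs i, j < i ∧ ∃ s ∈ [T.A, T.B], ∃ h ∈ T.H,
    T.rep i = comp s (comp h (T.rep j))
  out : ∀ i < T.n, ∀ s ∈ [T.A, T.B], ∀ h ∈ T.H, ∃ j ∈ T.nbrs i, ∃ k ∈ T.H,
    comp s (comp h (T.rep i)) = comp k (T.rep j)
  nbrs_spec : ∀ i < T.n, (T.nbrs i).Nodup ∧ ∀ j ∈ T.nbrs i, j < T.n ∧ j ≠ i ∧ i ∈ T.nbrs j ∧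
    ∃ s ∈ [T.A, T.B], ∃ h ∈ T.H, ∃ k ∈ T.H, comp s (comp h (T.rep i)) = comp k (T.rep j)
  base_lt : T.base < T.n
  pair_nodup : distinct T.pairColours = true
  -- The colour class of `base` lies in its H-orbit; two neighbours of vertex `0` differ in colour;
  -- the invariant has the recorded value.
  point_spec : (∀ w < T.n, T.pointColours.getD w 0 = T.pointColours.getD T.base 0 →
      ∃ h ∈ T.H, ∃ k ∈ T.H, comp k (T.rep w) = comp (T.rep T.base) h) ∧
    (∃ i ∈ T.nbrs 0, ∃ j ∈ T.nbrs 0,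
      T.pointColours.getD i 0 ≠ T.pointColours.getD j 0) ∧
    ((List.range T.n).map fun i => T.pointColours.getD i 0 ^ 2).sum = T.hash
  x_lt : T.x < T.n
  -- The products h · rep x are exactly the elements whose right multiplication takes the coset H to
  -- the vertex `x`.
  semiregular : ∀ h ∈ T.H,
    ∃ w ∈ [comp h (T.rep T.x), comp (comp h (T.rep T.x)) (comp h (T.rep T.x))],
    (∃ i < T.n, T.Fixes (T.rep i) w) ∧ ∃ i < T.n, ¬ T.Fixes (T.rep i) w
  lt : T.p < T.n ∧ T.q < T.n ∧ T.r < T.n ∧ T.c < T.n ∧ T.d < T.n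
  p_ne : T.p ≠ 0
  conj_q : comp (T.rep T.c) (T.rep T.p) = comp (T.rep T.q) (T.rep T.c)
  conj_r : comp (T.rep T.d) (T.rep T.p) = comp (T.rep T.r) (T.rep T.d)
  commutator : comp (T.rep T.p) (comp (T.rep T.r) (T.rep T.q)) = comp (T.rep T.q) (T.rep T.r)

/-- The table describes the coset graph given by `d`. -/
structure Models (d : CosetDatum) : Prop where
  code_a : code d.a = T.A
  code_b : code d.b = T.B
  mem_H : ∀ c, c ∈ T.H ↔ ∃ σ ∈ d.H, code σ = c
  card_le : Nat.card d.G ≤ T.n * T.H.length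

end Table
-- ### From a valid table to the properties of the graph
namespace Table

variable {T : Table} {d : CosetDatum}

theorem nbrs_eq {i : ℕ} (h : i < T.nb.length) :
    T.nbrs i = [T.nb[i].1, T.nb[i].2.1, T.nb[i].2.2] := by
  simp [nbrs, h]

/-- The right coset of `g`. -/
abbrev _root_.CubicVNC.CosetDatum.mk' (d : CosetDatum) (g : d.G) : d.Vertex := Quotient.mk _ g

namespace Models

theorem exists_subgroup (hM : T.Models d) {c : ℕ} (hc : c ∈ T.H) :
    ∃ h : d.G, h ∈ d.subgroup ∧ code h = c := by
  obtain ⟨σ, hσ, rfl⟩ := (hM.mem_H c).1 hc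
  exact ⟨⟨σ, d.H_le hσ⟩, hσ, rfl⟩

theorem code_mem (hM : T.Models d) {h : d.G} (hh : h ∈ d.subgroup) : code h ∈ T.H :=
  (hM.mem_H _).2 ⟨h, hh, rfl⟩

theorem mk_eq_mk_iff (hM : T.Models d) {x y : d.G} :
    d.mk' x = d.mk' y ↔ ∃ k ∈ T.H, code x = comp k (code y) := by
  rw [CubicVNC.mk_eq_mk_iff]
  constructor
  · rintro ⟨h, hh, rfl⟩
    exact ⟨_, hM.code_mem hh, code_mul _ _⟩
  · rintro ⟨k, hk, h⟩
    obtain ⟨g, hg, rfl⟩ := hM.exists_subgroup hk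
    refine ⟨g, hg, Subtype.ext (code_injective ?_)⟩
    rw [h, Subgroup.coe_mul, code_mul]

theorem exists_connection (hM : T.Models d) {s : ℕ} (hs : s ∈ [T.A, T.B]) :
    ∃ g : d.G, code g = s ∧ ∀ h ∈ d.subgroup, ∀ k ∈ d.subgroup, h * g * k ∈ d.connectionSet := by
  rw [List.mem_pair] at hs
  rcases hs with rfl | rfl
  · exact ⟨⟨d.a, d.a_mem⟩, hM.code_a, fun h hh k hk =>
      Or.inl (DoubleCoset.mem_doubleCoset.2 ⟨h, hh, k, hk, rfl⟩)⟩
  · exact ⟨⟨d.b, d.b_mem⟩, hM.code_b, fun h hh k hk =>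
      Or.inr (DoubleCoset.mem_doubleCoset.2 ⟨h, hh, k, hk, rfl⟩)⟩

theorem exists_of_mem_connectionSet (hM : T.Models d) {x : d.G} (hx : x ∈ d.connectionSet) :
    ∃ h ∈ d.subgroup, ∃ g : d.G, ∃ k ∈ d.subgroup, x = h * g * k ∧ code g ∈ [T.A, T.B] := by
  rcases hx with hx | hx <;>
    obtain ⟨h, hh, k, hk, rfl⟩ := DoubleCoset.mem_doubleCoset.1 hx
  · exact ⟨h, hh, _, k, hk, rfl, by simp [hM.code_a]⟩
  · exact ⟨h, hh, _, k, hk, rfl, by simp [hM.code_b]⟩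

end Models

/-- The elements `g i` have the codes listed in the table. -/
def IsLabelling (T : Table) (d : CosetDatum) (g : ℕ → d.G) : Prop :=
  ∀ i < T.n, code (g i) = T.rep i

/-- Along the spanning tree each representative is a product of elements already known to lie in G.
Indices beyond the table get the junk value 1. -/
theorem exists_labelling (hT : T.Valid) (hM : T.Models d) : ∃ g, T.IsLabelling d g := by
  have : ∀ i, ∃ g : d.G, i < T.n → code g = T.rep i := by
    intro i
    induction i using Nat.strong_induction_on with
    | _ i ih =>
      by_cases hi : i < T.n
      · rcases hT.reach i hi with rfl | ⟨j, -, hji, s, hs, h, hh, e⟩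
        · exact ⟨1, fun _ => hT.rep_zero.symm⟩
        · obtain ⟨g, hg⟩ := ih j hji
          obtain ⟨t, rfl, -⟩ := hM.exists_connection hs
          obtain ⟨k, -, rfl⟩ := hM.exists_subgroup hh
          refine ⟨t * (k * g), fun _ => ?_⟩
          rw [e, Subgroup.coe_mul, Subgroup.coe_mul, code_mul, code_mul, hg (hji.trans hi)]
      · exact ⟨1, fun h => absurd h hi⟩
  choose g hg using this
  exact ⟨g, hg⟩

theorem label_zero {g : ℕ → d.G} (hT : T.Valid) (hg : T.IsLabelling d g) : g 0 = 1 :=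
  Subtype.ext (code_injective ((hg 0 hT.pos).trans hT.rep_zero))

/-- The inverse appears because the action is made a left action by multiplying cosets on the right
by inverses. -/
theorem fixes_iff {g : ℕ → d.G} (hM : T.Models d) (hg : T.IsLabelling d g) {i : ℕ} (hi : i < T.n) (x : d.G) :
    T.Fixes (T.rep i) (code x) ↔
      cosetAction d.subgroup d.connectionSet x⁻¹ (d.mk' (g i)) = d.mk' (g i) := by
  rw [cosetAction_mk, inv_inv, hM.mk_eq_mk_iff, Fixes, ← hg i hi, Subgroup.coe_mul, code_mul]

section

variable {g : ℕ → d.G} (hT : T.Valid) (hM : T.Models d) (hg : T.IsLabelling d g)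
include hT hM hg

theorem label_injective {i j : ℕ} (hi : i < T.n) (hj : j < T.n)
    (h : d.mk' (g i) = d.mk' (g j)) : i = j := by
  obtain ⟨k, hk, e⟩ := hM.mk_eq_mk_iff.1 h
  -- `l` is the code of the identity; it exhibits `code (g i)` in the block of i, while `k` puts it
  -- in the block of j. These blocks are disjoint unless i = j.
  obtain ⟨l, hl, e'⟩ := hM.mk_eq_mk_iff.1 (rfl : d.mk' (g i) = d.mk' (g i))
  have hpw := (List.nodup_flatMap.1 (nodup_of_distinct hT.nodup)).2
  rw [List.pairwise_iff_getElem] at hpw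
  have hrep : ∀ {i} (hi : i < T.n), T.R[i]'hi = code (g i) := fun {i} hi => by
    rw [hg i hi, rep, List.getD_eq_getElem _ _ hi]
  rcases lt_trichotomy i j with hij | hij | hij
  · refine absurd (hpw i j hi hj hij) fun hd => hd ?_ ?_ (a := code (g i))
    · exact List.mem_map.2 ⟨l, hl, by rw [hrep hi, ← e']⟩
    · exact List.mem_map.2 ⟨k, hk, by rw [hrep hj, ← e]⟩
  · exact hij
  · refine absurd (hpw j i hj hi hij) fun hd => hd ?_ ?_ (a := code (g i))
    · exact List.mem_map.2 ⟨k, hk, by rw [hrep hj, ← e]⟩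
    · exact List.mem_map.2 ⟨l, hl, by rw [hrep hi, ← e']⟩

/-- Counting: the table lists n|H| distinct codes of elements of G, and |G| is at most n|H|, so
every element of G is listed. -/
theorem label_surjective (w : d.Vertex) : ∃ i < T.n, d.mk' (g i) = w := by
  classical
  obtain ⟨y, rfl⟩ := Quotient.exists_rep w
  have : Fintype d.G := Fintype.ofFinite _
  set L := T.R.flatMap fun r => T.H.map fun h => comp h r with hL
  have hlen : L.length = T.n * T.H.length := by
    simp [hL, List.length_flatMap, n]
  have hrep : ∀ c ∈ L, ∃ i < T.n, ∃ k ∈ T.H, c = comp k (code (g i)) := by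
    intro c hc
    obtain ⟨r, hr, hc⟩ := List.mem_flatMap.1 hc
    obtain ⟨k, hk, rfl⟩ := List.mem_map.1 hc
    obtain ⟨i, hi, rfl⟩ := List.getElem_of_mem hr
    exact ⟨i, hi, k, hk, by rw [hg i hi, rep, List.getD_eq_getElem _ _ hi]⟩
  have hsub : L.toFinset ⊆ Finset.univ.image fun x : d.G => code x := by
    intro c hc
    obtain ⟨i, hi, k, hk, rfl⟩ := hrep c (List.mem_toFinset.1 hc)
    obtain ⟨h, -, rfl⟩ := hM.exists_subgroup hk
    exact Finset.mem_image.2 ⟨h * g i, Finset.mem_univ _, by rw [Subgroup.coe_mul, code_mul]⟩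
  have heq := Finset.eq_of_subset_of_card_le hsub (by
    rw [List.toFinset_card_of_nodup (nodup_of_distinct hT.nodup), hlen]
    refine Finset.card_image_le.trans ?_
    rw [Finset.card_univ, ← Nat.card_eq_fintype_card]
    exact hM.card_le)
  have hy : code y ∈ L := by
    rw [← List.mem_toFinset, heq]
    exact Finset.mem_image_of_mem _ (Finset.mem_univ _)
  obtain ⟨i, hi, k, hk, e⟩ := hrep _ hy
  exact ⟨i, hi, (hM.mk_eq_mk_iff.2 ⟨k, hk, e⟩).symm⟩

/-- The vertices of the coset graph are in bijection with the rows of the table. -/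
noncomputable def vertexEquiv : Fin T.n ≃ d.Vertex :=
  Equiv.ofBijective (fun i => d.mk' (g i))
    ⟨fun i j h => Fin.ext (label_injective hT hM hg i.2 j.2 h), fun w => by
      obtain ⟨i, hi, h⟩ := label_surjective hT hM hg w
      exact ⟨⟨i, hi⟩, h⟩⟩

theorem adj_label_iff {i : ℕ} (hi : i < T.n) (w : d.Vertex) :
    d.graph.Adj (d.mk' (g i)) w ↔ ∃ j ∈ T.nbrs i, w = d.mk' (g j) := by
  -- In a product h s k · l g_i the left factor h is absorbed by the coset and k l is again in H, so
  -- only the products s h g_i need checking.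
  have hout : ∀ {i}, i < T.n → ∀ w, (∃ x : d.G, ∃ t ∈ d.connectionSet, d.mk' (g i) = d.mk' x ∧
      w = d.mk' (t * x)) ↔ ∃ j ∈ T.nbrs i, w = d.mk' (g j) := by
    intro i hi w
    constructor
    · rintro ⟨x, t, ht, e, rfl⟩
      obtain ⟨h, hh, s, k, hk, rfl, hs⟩ := hM.exists_of_mem_connectionSet ht
      obtain ⟨l, hl, rfl⟩ := (CubicVNC.mk_eq_mk_iff _).1 e.symm
      obtain ⟨j, hj, m, hm, e⟩ := hT.out i hi _ hs _ (hM.code_mem (mul_mem hk hl))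
      refine ⟨j, hj, ?_⟩
      have h1 : d.mk' (h * s * k * (l * g i)) = d.mk' (s * (k * l * g i)) :=
        (CubicVNC.mk_eq_mk_iff _).2 ⟨h, hh, by simp [mul_assoc]⟩
      rw [h1, hM.mk_eq_mk_iff]
      refine ⟨m, hm, ?_⟩
      rw [hg j ((hT.nbrs_spec i hi).2 j hj).1, ← e, ← hg i hi, ← code_mul, ← code_mul]
      rfl
    · rintro ⟨j, hj, rfl⟩
      obtain ⟨hjn, -, -, s, hs, h, hh, k, hk, e⟩ := (hT.nbrs_spec i hi).2 j hj
      obtain ⟨t, rfl, ht⟩ := hM.exists_connection hs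
      obtain ⟨l, hl, rfl⟩ := hM.exists_subgroup hh
      refine ⟨g i, t * l, by simpa using ht 1 (one_mem _) l hl, rfl, Eq.symm ?_⟩
      rw [hM.mk_eq_mk_iff]
      refine ⟨k, hk, ?_⟩
      rw [hg j hjn, ← e, ← hg i hi, ← code_mul, ← code_mul, mul_assoc]
      rfl
  rw [CosetDatum.graph, cosetGraph, SimpleGraph.fromRel_adj]
  obtain ⟨j, hj, rfl⟩ := label_surjective hT hM hg w
  rw [hout hi, hout hj]
  constructor
  -- The reversed relation, added by symmetrisation, is absorbed by the symmetry of the neighbour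
  -- lists.
  · rintro ⟨-, h | ⟨k, hk, e⟩⟩
    · exact h
    · obtain ⟨hkn, -, hk', -⟩ := (hT.nbrs_spec j hj).2 k hk
      rw [← label_injective hT hM hg hi hkn e] at hk'
      exact ⟨j, hk', rfl⟩
  · rintro ⟨k, hk, e⟩
    obtain ⟨hkn, hki, -, -⟩ := (hT.nbrs_spec i hi).2 k hk
    refine ⟨fun e' => hki ?_, Or.inl ⟨k, hk, e⟩⟩
    exact (label_injective hT hM hg hi hkn (e'.trans e)).symm

theorem isNeighbourTable : IsNeighbourTable d.graph (fun i => d.mk' (g i)) T.nb := by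
  intro i hi
  have hi' : i < T.n := hT.length_nb ▸ hi
  obtain ⟨hnd, hlt⟩ := hT.nbrs_spec i hi'
  have hadj := adj_label_iff hT hM hg hi'
  rw [nbrs_eq hi] at hnd hlt hadj
  have l1 := (hlt T.nb[i].1 (by simp)).1
  have l2 := (hlt T.nb[i].2.1 (by simp)).1
  have l3 := (hlt T.nb[i].2.2 (by simp)).1
  simp only [List.nodup_cons, List.mem_cons, List.not_mem_nil, or_false, not_or] at hnd
  have hinj := @label_injective _ _ _ hT hM hg
  refine ⟨?_, fun e => hnd.1.1 (hinj l1 l2 e), fun e => hnd.1.2 (hinj l1 l3 e),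
    fun e => hnd.2.1 (hinj l2 l3 e), ?_, ?_, ?_⟩
  · ext w
    rw [SimpleGraph.mem_neighborSet, hadj]
    simp
  all_goals rwa [hT.length_nb]

theorem isCubic : IsCubic d.graph := by
  intro w
  obtain ⟨i, hi, rfl⟩ := label_surjective hT hM hg w
  obtain ⟨h, h12, h13, h23, -⟩ := isNeighbourTable hT hM hg i (by rwa [hT.length_nb])
  exact Set.ncard_eq_three.2 ⟨_, _, _, h12, h13, h23, h⟩

theorem connected : d.graph.Connected := by
  have h0 : ∀ i, i < T.n → d.graph.Reachable (d.mk' (g 0)) (d.mk' (g i)) := by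
    intro i
    induction i using Nat.strong_induction_on with
    | _ i ih =>
      intro hi
      rcases hT.reach i hi with rfl | ⟨j, hj, hji, -⟩
      · rfl
      · exact (ih j hji (hji.trans hi)).trans
          ((adj_label_iff hT hM hg hi _).2 ⟨j, hj, rfl⟩).symm.reachable
  have : Nonempty d.Vertex := ⟨d.mk' 1⟩
  refine ⟨fun u v => ?_⟩
  obtain ⟨i, hi, rfl⟩ := label_surjective hT hM hg u
  obtain ⟨j, hj, rfl⟩ := label_surjective hT hM hg v
  exact (h0 i hi).symm.trans (h0 j hj)

theorem getD_pointColours {i : ℕ} (hi : i < T.n) :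
    T.pointColours.getD i 0 = colour d.graph (pointColour (d.mk' (g 0))) 10 (d.mk' (g i)) := by
  refine (isNeighbourTable hT hM hg).getD_colourList (by simp [hT.length_nb]) (fun j hj => ?_) 10
    (by rwa [hT.length_nb])
  rw [hT.length_nb] at hj
  have : d.mk' (g j) = d.mk' (g 0) ↔ j = 0 :=
    ⟨label_injective hT hM hg hj hT.pos, fun h => h ▸ rfl⟩
  rw [pointColour, List.getD_eq_getElem _ _ (by simpa using hj)]
  simp [this]

theorem getD_pairColours {i : ℕ} (hi : i < T.n) :
    T.pairColours.getD i 0 =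
      colour d.graph (pairColour (d.mk' (g 0)) (d.mk' (g T.base))) 10 (d.mk' (g i)) := by
  refine (isNeighbourTable hT hM hg).getD_colourList (by simp [hT.length_nb]) (fun j hj => ?_) 10
    (by rwa [hT.length_nb])
  rw [hT.length_nb] at hj
  have h1 : d.mk' (g j) = d.mk' (g 0) ↔ j = 0 :=
    ⟨label_injective hT hM hg hj hT.pos, fun h => h ▸ rfl⟩
  have h2 : d.mk' (g j) = d.mk' (g T.base) ↔ j = T.base :=
    ⟨label_injective hT hM hg hj hT.base_lt, fun h => h ▸ rfl⟩
  rw [pairColour, List.getD_eq_getElem _ _ (by simpa using hj)]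
  simp [h1, h2]

theorem injective_colour_pair : Function.Injective
    (colour d.graph (pairColour (d.mk' (g 0)) (d.mk' (g T.base))) 10) := by
  intro u v h
  obtain ⟨i, hi, rfl⟩ := label_surjective hT hM hg u
  obtain ⟨j, hj, rfl⟩ := label_surjective hT hM hg v
  rw [← getD_pairColours hT hM hg hi, ← getD_pairColours hT hM hg hj] at h
  have hl : T.pairColours.length = T.n := by
    rw [← hT.length_nb]
    exact length_colourList (by simp [hT.length_nb]) 10
  rw [List.getD_eq_getElem _ _ (hl ▸ hi), List.getD_eq_getElem _ _ (hl ▸ hj),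
    (nodup_of_distinct hT.pair_nodup).getElem_inj_iff] at h
  rw [h]

/-- Vertex-transitivity moves the distinguished vertex to vertex `0`, where the table computes the
sum. -/
theorem pointHash_eq (v : d.Vertex) : pointHash d.graph 10 v = T.hash := by
  obtain ⟨f, rfl⟩ : ∃ f : d.graph ≃g d.graph, f (d.mk' (g 0)) = v :=
    isVertexTransitive_cosetGraph _ _ _ _
  rw [pointHash_iso, ← hT.point_spec.2.2, pointHash,
    ← finsum_comp_equiv (vertexEquiv hT hM hg), finsum_eq_sum_of_fintype]
  change ∑ i : Fin T.n, colour d.graph _ 10 (d.mk' (g i)) ^ 2 = _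
  rw [Finset.sum_congr rfl fun (i : Fin T.n) _ => by
    rw [← getD_pointColours hT hM hg i.2],
    Fin.sum_univ_eq_sum_range (fun i => T.pointColours.getD i 0 ^ 2)]
  rfl

theorem not_isArcTransitive : ¬ IsArcTransitive d.graph := by
  intro h
  obtain ⟨i, hi, j, hj, hne⟩ := hT.point_spec.2.1
  have hi' := ((hT.nbrs_spec 0 hT.pos).2 i hi).1
  have hj' := ((hT.nbrs_spec 0 hT.pos).2 j hj).1
  obtain ⟨f, h0, h1⟩ := h (d.mk' (g 0)) (d.mk' (g i)) (d.mk' (g 0)) (d.mk' (g j))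
    ((adj_label_iff hT hM hg hT.pos _).2 ⟨i, hi, rfl⟩)
    ((adj_label_iff hT hM hg hT.pos _).2 ⟨j, hj, rfl⟩)
  refine hne ?_
  rw [getD_pointColours hT hM hg hi', getD_pointColours hT hM hg hj', ← h1]
  have := colour_point_iso f (d.mk' (g 0)) (d.mk' (g i)) 10
  rw [h0] at this
  exact this.symm

/-- The full automorphism group is the group that defines the coset graph. -/
theorem cosetAction_surjective :
    Function.Surjective (cosetAction d.subgroup d.connectionSet) := by
  intro (f : d.graph ≃g d.graph)
  let ρ : d.G →* (d.graph ≃g d.graph) := cosetAction d.subgroup d.connectionSet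
  have hρ : ∀ x y, ρ x (d.mk' y) = d.mk' (y * x⁻¹) := fun x y => rfl
  have h0 := label_zero hT hg
  obtain ⟨y, hy⟩ := Quotient.exists_rep (f (d.mk' (g 0)))
  -- First correction: y represents the image of H, so `ρ y` brings it back.
  have e0 : (ρ y * f) (d.mk' (g 0)) = d.mk' (g 0) := by
    rw [RelIso.mul_apply, ← hy]
    change ρ y (d.mk' y) = _
    rw [hρ, h0, mul_inv_cancel]
  obtain ⟨w, hw, ew⟩ := label_surjective hT hM hg ((ρ y * f) (d.mk' (g T.base)))
  have hc := colour_point_iso (ρ y * f) (d.mk' (g 0)) (d.mk' (g T.base)) 10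
  rw [e0, ← ew, ← getD_pointColours hT hM hg hw, ← getD_pointColours hT hM hg hT.base_lt] at hc
  obtain ⟨h, hh, k, hk, e⟩ := hT.point_spec.1 w hw hc
  obtain ⟨h, hhH, rfl⟩ := hM.exists_subgroup hh
  rw [← hg w hw, ← hg _ hT.base_lt, ← code_mul] at e
  have e1 : d.mk' (g T.base * h) = d.mk' (g w) :=
    hM.mk_eq_mk_iff.2 ⟨k, hk, e.symm⟩
  -- Second correction: h lies in H, hence `ρ h` keeps vertex `0` fixed, and it returns the image of
  -- `base` to `base`.
  have e2 : ρ h * (ρ y * f) = 1 := by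
    refine iso_eq_of_colour_pair_injective (injective_colour_pair hT hM hg) _ ?_ ?_
    · rw [RelIso.mul_apply, e0, hρ, h0, one_mul]
      exact (CubicVNC.mk_eq_mk_iff _).2 ⟨h⁻¹, inv_mem hhH, by simp⟩
    · rw [RelIso.mul_apply, ← ew, ← e1, hρ, mul_inv_cancel_right]
  refine ⟨(h * y)⁻¹, ?_⟩
  change ρ (h * y)⁻¹ = f
  rw [map_inv, inv_eq_iff_mul_eq_one, map_mul, mul_assoc, e2]

theorem not_isCayley : ¬ IsCayley d.graph := by
  intro hC
  obtain ⟨f, hf, hreg⟩ := hC.exists_regular (d.mk' (g 0)) (d.mk' (g T.x))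
  obtain ⟨z, rfl⟩ := cosetAction_surjective hT hM hg f
  rw [label_zero hT hg] at hf
  change d.mk' (1 * z⁻¹) = _ at hf
  rw [one_mul] at hf
  obtain ⟨h, hh, e⟩ := (CubicVNC.mk_eq_mk_iff _).1 hf
  have hz : code (z⁻¹ : d.G) = comp (code h) (T.rep T.x) := by
    rw [e, Subgroup.coe_mul, code_mul, hg _ hT.x_lt]
  obtain ⟨w, hw, ⟨i, hi, hfix⟩, ⟨j, hj, hnfix⟩⟩ := hT.semiregular _ (hM.code_mem hh)
  -- The power fixing some but not all vertices has exponent 1 or 2.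
  obtain ⟨k, rfl⟩ : ∃ k : ℕ, w = code ((z ^ k)⁻¹ : d.G) := by
    rw [← hz, List.mem_pair] at hw
    rcases hw with rfl | rfl
    · exact ⟨1, by simp⟩
    · exact ⟨2, by rw [← code_mul]; simp [pow_two]⟩
  rw [fixes_iff hM hg hi, inv_inv, map_pow] at hfix
  rw [fixes_iff hM hg hj, inv_inv, map_pow] at hnfix
  exact hnfix (congrArg (fun f : d.graph ≃g d.graph => f (d.mk' (g j))) (hreg k _ hfix))

theorem not_isSolvable : ¬ Group.IsSolvable (d.graph ≃g d.graph) := by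
  obtain ⟨hp, hq, hr, hc, hd⟩ := hT.lt
  have mul_eq : ∀ {i j k l}, i < T.n → j < T.n → k < T.n → l < T.n →
      comp (T.rep i) (T.rep j) = comp (T.rep k) (T.rep l) → g i * g j = g k * g l := by
    intro i j k l hi hj hk hl h
    refine Subtype.ext (code_injective ?_)
    rw [Subgroup.coe_mul, Subgroup.coe_mul, code_mul, code_mul, hg i hi, hg j hj, hg k hk,
      hg l hl, h]
  have eq := mul_eq hc hp hq hc hT.conj_q
  have er := mul_eq hd hp hr hd hT.conj_r
  have ec : g T.p * (g T.r * g T.q) = g T.q * g T.r := by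
    refine Subtype.ext (code_injective ?_)
    simp only [Subgroup.coe_mul, code_mul]
    rw [hg _ hp, hg _ hq, hg _ hr, hT.commutator]
  let ρ : d.G →* (d.graph ≃g d.graph) := cosetAction d.subgroup d.connectionSet
  refine not_isSolvable_of_eq_commutator (x := ρ (g T.p)) (c := ρ (g T.c)) (d := ρ (g T.d)) ?_ ?_
  -- Faithfulness of the action is not needed: p represents a coset other than H, so its inverse
  -- visibly moves the vertex H.
  · intro h
    have h' : ρ (g T.p)⁻¹ (d.mk' 1) = d.mk' 1 := by
      rw [map_inv, h]
      rfl
    change d.mk' (1 * (g T.p)⁻¹⁻¹) = _ at h'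
    rw [one_mul, inv_inv, ← label_zero hT hg] at h'
    exact hT.p_ne (label_injective hT hM hg hp hT.pos h')
  · rw [← map_mul, ← map_mul, ← map_inv, ← map_inv, ← map_mul, ← map_mul, eq, er,
      mul_inv_cancel_right, mul_inv_cancel_right, ← map_commutatorElement]
    congr 1
    rw [commutatorElement_def, eq_mul_inv_iff_mul_eq, eq_mul_inv_iff_mul_eq, mul_assoc, ec]

end

theorem main (hT : T.Valid) (hM : T.Models d) :
    Nat.card d.Vertex = T.n ∧ IsCubic d.graph ∧ IsVNC d.graph ∧ ¬ IsArcTransitive d.graph ∧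
      ¬ Group.IsSolvable (d.graph ≃g d.graph) ∧ ∀ v, pointHash d.graph 10 v = T.hash := by
  obtain ⟨g, hg⟩ := exists_labelling hT hM
  have e := vertexEquiv hT hM hg
  exact ⟨by rw [← Nat.card_congr e, Nat.card_fin], isCubic hT hM hg,
    ⟨Finite.of_equiv _ e, connected hT hM hg, isVertexTransitive_cosetGraph _ _,
      not_isCayley hT hM hg⟩,
    not_isArcTransitive hT hM hg, not_isSolvable hT hM hg, pointHash_eq hT hM hg⟩

end Table
/-! ### The orders of the groups -/

/-- As z is an involution or trivial and commutes with A, the union of A and Az is already a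
subgroup. -/
theorem card_sup_zpowers_le {G : Type*} [Group G] [Finite G] (A : Subgroup G) {z : G}
    (hz : z * z = 1) (hc : ∀ s ∈ A, Commute s z) :
    Nat.card (A ⊔ Subgroup.zpowers z : Subgroup G) ≤ 2 * Nat.card A := by
  let B : Subgroup G :=
    { carrier := {g | g ∈ A ∨ g * z ∈ A}
      one_mem' := Or.inl A.one_mem
      mul_mem' := by
        have aux : ∀ {g : G}, g * z ∈ A → Commute g z := fun {g} hg => by
          have := (hc _ hg).mul_left ((Commute.refl z).inv_left)
          simpa using this
        rintro x y (hx | hx) (hy | hy)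
        · exact Or.inl (A.mul_mem hx hy)
        · exact Or.inr (by simpa [mul_assoc] using A.mul_mem hx hy)
        · refine Or.inr ?_
          have := A.mul_mem hx hy
          rwa [mul_assoc, ← (hc y hy).eq, ← mul_assoc] at this
        · refine Or.inl ?_
          have := A.mul_mem hx hy
          rwa [mul_assoc, ← mul_assoc z y z, ← (aux hy).eq, mul_assoc y, hz, mul_one] at this
      inv_mem' := by
        have hz' : z⁻¹ = z := inv_eq_of_mul_eq_one_left hz
        rintro x (hx | hx)
        · exact Or.inl (A.inv_mem hx)
        · refine Or.inr ?_
          have h1 : Commute x z := by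
            have := (hc _ hx).mul_left ((Commute.refl z).inv_left)
            simpa using this
          have := A.inv_mem hx
          rwa [h1.eq, mul_inv_rev, hz'] at this }
  have hle : A ⊔ Subgroup.zpowers z ≤ B := by
    refine sup_le (fun g hg => Or.inl hg) ?_
    rw [Subgroup.zpowers_le]
    exact Or.inr (by rw [hz]; exact A.one_mem)
  refine (Subgroup.card_le_of_le hle).trans ?_
  classical
  let f : A × Bool → B := fun p =>
    if p.2 then ⟨p.1, Or.inl p.1.2⟩ else ⟨p.1 * z, Or.inr (by rw [mul_assoc, hz, mul_one]; exact p.1.2)⟩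
  have hf : Function.Surjective f := by
    rintro ⟨g, hg | hg⟩
    · exact ⟨(⟨g, hg⟩, true), rfl⟩
    · exact ⟨(⟨_, hg⟩, false), Subtype.ext (by simp [f, mul_assoc, hz])⟩
  refine (Nat.card_le_card_of_surjective f hf).trans ?_
  rw [Nat.card_prod, mul_comm]
  simp

theorem card_S5 : Nat.card S5 = 120 := by
  have e : S5 ≃ {f : Perm (Fin 8) // ∀ a, ¬ (a ≠ 6 ∧ a ≠ 7 ∧ a ≠ 8) → f a = a} :=
    Equiv.subtypeEquivRight fun σ => by
      rw [S5, mem_fixingSubgroup_iff]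
      refine forall_congr' fun a => ?_
      have : a ∈ ({6, 7, 8} : Set (Fin 8)) ↔ ¬ (a ≠ 6 ∧ a ≠ 7 ∧ a ≠ 8) := by
        simp only [Set.mem_insert_iff, Set.mem_singleton_iff]
        tauto
      rw [this]
      rfl
  rw [Nat.card_congr (e.trans (Perm.subtypeEquivSubtypePerm _).symm), Nat.card_perm,
    Nat.card_eq_fintype_card]
  decide

theorem commute_S5 {σ : Perm (Fin 8)} (h : σ ∈ S5) : Commute σ c[6, 7] := by
  rw [S5, mem_fixingSubgroup_iff] at h
  have h6 : σ 6 = 6 := h 6 (by simp)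
  have h7 : σ 7 = 7 := h 7 (by simp)
  have : (c[6, 7] : Perm (Fin 8)) = swap 6 7 := by decide
  rw [this]
  change σ * swap 6 7 = swap 6 7 * σ
  rw [mul_swap_eq_swap_mul, h6, h7]

/-- The order divides 120 and differs from 120, because a transposition is missing; a proper divisor
is at most half. -/
theorem card_A5_le : Nat.card A5 ≤ 60 := by
  have hle : A5 ≤ S5 := inf_le_left
  have hne : Nat.card A5 ≠ 120 := by
    intro h
    have heq : A5 = S5 := Subgroup.eq_of_le_of_card_ge hle (by rw [h, card_S5])
    have hmem : (c[1, 2] : Perm (Fin 8)) ∈ A5 := heq ▸ mem_S5 (by decide)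
    exact absurd (Perm.mem_alternatingGroup.1 hmem.2) (by decide)
  obtain ⟨k, hk⟩ := card_S5 ▸ Subgroup.card_dvd_of_le hle
  rcases k with _ | _ | k
  · omega
  · omega
  · nlinarith [Nat.zero_le (Nat.card A5 * k)]

theorem card_S5Z2_le : Nat.card S5Z2 ≤ 240 := by
  have := card_sup_zpowers_le S5 (z := c[6, 7]) (by decide) fun s hs => commute_S5 hs
  rwa [card_S5] at this

theorem card_A5Z2_le : Nat.card A5Z2 ≤ 120 := by
  have := card_sup_zpowers_le A5 (z := c[6, 7]) (by decide) fun s hs => commute_S5 hs.1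
  exact this.trans (Nat.mul_le_mul_left 2 card_A5_le)

/-- The labels 8, 4, 1 stand for ∞, 0, 1. Fixing ∞ kills the lower left entry of the matrix, fixing
0 the upper right one, and fixing 1 equates the diagonal entries: the matrix is scalar. -/
theorem eq_one_of_mem_PGL27 {σ : Perm (Fin 8)} (h : σ ∈ PGL27) (h8 : σ 8 = 8) (h4 : σ 4 = 4)
    (h1 : σ 1 = 1) : σ = 1 := by
  obtain ⟨M, hM⟩ := h
  have e8 := hM 8
  have e4 := hM 4
  have e1 := hM 1
  rw [h8] at e8
  rw [h4] at e4
  rw [h1] at e1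
  have hl : Function.Injective label := by decide
  have l8 : label 8 = OnePoint.infty := rfl
  have l4 : label 4 = ((0 : ZMod 7) : OnePoint (ZMod 7)) := rfl
  have l1 : label 1 = ((1 : ZMod 7) : OnePoint (ZMod 7)) := rfl
  rw [l8, eq_comm, OnePoint.smul_infty_eq_self_iff] at e8
  have hdet : M.1 0 0 * M.1 1 1 - M.1 0 1 * M.1 1 0 ≠ 0 := by
    rw [← Matrix.det_fin_two]
    exact (Matrix.isUnit_iff_isUnit_det _).1 M.isUnit |>.ne_zero
  rw [l4, OnePoint.smul_some_eq_ite] at e4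
  rw [l1, OnePoint.smul_some_eq_ite] at e1
  rw [e8] at hdet
  have hd : M.1 1 1 ≠ 0 := by rintro h; simp [h] at hdet
  simp [e8, hd] at e4 e1
  have e01 : M.1 0 1 = 0 := by
    rcases div_eq_zero_iff.1 e4.symm with h | h
    exacts [h, absurd h hd]
  have e11 : M.1 0 0 = M.1 1 1 := by
    rw [e01, add_zero, eq_div_iff hd, one_mul] at e1
    exact e1.symm
  have key : ∀ x : OnePoint (ZMod 7), M • x = x := by
    intro x
    cases x with
    | infty => rwa [OnePoint.smul_infty_eq_self_iff]
    | coe t => 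
      rw [OnePoint.smul_some_eq_ite]
      simp [e8, e01, e11, hd]
  ext k
  rw [hl ((hM k).trans (key _))]
  rfl

/-- An element is determined by the images of ∞, 0, 1, which leaves at most 8 · 7 · 6 possibilities.
-/
theorem card_PGL27_le : Nat.card PGL27 ≤ 336 := by
  let f : PGL27 → (Fin 3 ↪ Fin 8) := fun σ => 
    ⟨fun i => σ.1 (![8, 4, 1] i), σ.1.injective.comp (by decide)⟩
  have hf : Function.Injective f := by
    intro σ τ h
    have hk : ∀ i, σ.1 (![8, 4, 1] i) = τ.1 (![8, 4, 1] i) := fun i =>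
      congrFun (congrArg DFunLike.coe h) i
    have := eq_one_of_mem_PGL27 (PGL27.mul_mem (PGL27.inv_mem τ.2) σ.2)
      (by rw [Perm.mul_apply, Perm.inv_eq_iff_eq]; exact hk 0)
      (by rw [Perm.mul_apply, Perm.inv_eq_iff_eq]; exact hk 1)
      (by rw [Perm.mul_apply, Perm.inv_eq_iff_eq]; exact hk 2)
    exact Subtype.ext (inv_mul_eq_one.1 this).symm
  refine (Nat.card_le_card_of_injective f hf).trans ?_
  rw [Nat.card_eq_fintype_card, Fintype.card_embedding_eq]
  decide

/-! ### The subgroups -/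

theorem mem_closure_involution {G : Type*} [Group G] {x : G} (hx : x * x = 1) (g : G) :
    g ∈ Subgroup.closure {x} ↔ g = 1 ∨ g = x := by
  constructor
  · intro h
    induction h using Subgroup.closure_induction with
    | mem y hy => exact Or.inr hy
    | one => exact Or.inl rfl
    | mul y z _ _ hy hz =>
      rcases hy with rfl | rfl <;> rcases hz with rfl | rfl <;> simp [hx]
    | inv y _ hy =>
      rcases hy with rfl | rfl <;> simp [inv_eq_of_mul_eq_one_left hx]
  · rintro (rfl | rfl)
    exacts [one_mem _, Subgroup.subset_closure rfl]

theorem mem_closure_four_group {G : Type*} [Group G] {x y : G} (hx : x * x = 1) (hy : y * y = 1)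
    (hxy : x * y = y * x) (g : G) :
    g ∈ Subgroup.closure {x, y} ↔ g = 1 ∨ g = x ∨ g = y ∨ g = x * y := by
  have hxx : ∀ z, x * (x * z) = z := fun z => by rw [← mul_assoc, hx, one_mul]
  -- As rewriting rules, these move x to the left of y and cancel squares, giving a normal form for
  -- words in x and y.
  have hyx : ∀ z, y * (x * z) = x * (y * z) := fun z => by rw [← mul_assoc, ← hxy, mul_assoc]
  constructor
  · intro h
    induction h using Subgroup.closure_induction with
    | mem z hz => rcases hz with rfl | rfl <;> simp
    | one => exact Or.inl rfl
    | mul u v _ _ hu hv =>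
      rcases hu with rfl | rfl | rfl | rfl <;> rcases hv with rfl | rfl | rfl | rfl <;>
        simp [mul_assoc, hx, hy, ← hxy, hxx, hyx]
    | inv u _ hu =>
      have hx' := inv_eq_of_mul_eq_one_left hx
      have hy' := inv_eq_of_mul_eq_one_left hy
      rcases hu with rfl | rfl | rfl | rfl <;> simp [hx', hy', hxy]
  · have mx : x ∈ Subgroup.closure {x, y} := Subgroup.subset_closure (by simp)
    have my : y ∈ Subgroup.closure {x, y} := Subgroup.subset_closure (by simp)
    rintro (rfl | rfl | rfl | rfl)
    exacts [one_mem _, mx, my, mul_mem mx my]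

theorem mem_codes_involution {x : Perm (Fin 8)} (hx : x * x = 1) {l : List ℕ}
    (hl : l = [code 1, code x]) (c : ℕ) :
    c ∈ l ↔ ∃ σ ∈ Subgroup.closure {x}, code σ = c := by
  simp [hl, mem_closure_involution hx, eq_comm]

theorem mem_codes_four_group {x y : Perm (Fin 8)} (h : x * x = 1 ∧ y * y = 1 ∧ x * y = y * x)
    {l : List ℕ} (hl : l = [code 1, code x, code y, code (x * y)]) (c : ℕ) :
    c ∈ l ↔ ∃ σ ∈ Subgroup.closure {x, y}, code σ = c := by
  simp [hl, mem_closure_four_group h.1 h.2.1 h.2.2, eq_comm]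

/-! ### The tables of the nine graphs -/

/-- The table of `NC 0`. -/
def table0 : Table where
  H := [16434824, 16335704]
  A := 16372496
  B := 16336712
  R :=
    [16434824, 16372496, 16405704, 16336712, 16299360, 16360232, 16431184, 16394952, 16405200,
    16373000, 16300704, 16303448, 16331616, 16332904, 16434768, 16431240, 16430176, 16392936,
    16300368, 16362248, 16324392, 16296168, 16341192, 16304792, 16389352, 16429728, 16390808,
    16362080, 16372384, 16336488, 16358160, 16333128, 16333408, 16434264, 16300200, 16303952,
    16393048, 16422672, 16337496, 16308432, 16427208, 16340744, 16390864, 16356648, 16426760,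
    16389464, 16303784, 16372832, 16360288, 16405144, 16389800, 16373896, 16325400, 16339680,
    16370256, 16389968, 16361800, 16422168, 16425696, 16368744]
  nb :=
    [(1, 2, 3), (4, 0, 5), (6, 0, 7), (8, 9, 0), (6, 1, 10), (11, 12, 1), (4, 2, 13), (14, 15, 2),
    (16, 3, 17), (18, 3, 19), (20, 21, 4), (22, 5, 23), (24, 5, 25), (26, 27, 6), (28, 7, 29),
    (30, 7, 31), (18, 8, 32), (33, 25, 8), (16, 9, 34), (35, 31, 9), (36, 10, 37),
    (38, 10, 39), (24, 11, 40), (41, 39, 11), (22, 12, 42), (43, 17, 12), (44, 13, 45),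
    (46, 13, 47), (30, 14, 48), (49, 47, 14), (28, 15, 43), (42, 19, 15), (50, 39, 16),
    (51, 17, 38), (52, 47, 18), (53, 19, 46), (38, 20, 49), (48, 45, 20), (36, 21, 33),
    (32, 23, 21), (54, 45, 22), (50, 23, 44), (53, 31, 24), (51, 25, 30), (46, 26, 41),
    (40, 37, 26), (44, 27, 35), (34, 29, 27), (54, 37, 28), (52, 29, 36), (41, 32, 55),
    (43, 33, 56), (49, 34, 57), (42, 35, 58), (48, 40, 59), (58, 57, 50), (59, 57, 51),
    (56, 55, 52), (59, 55, 53), (56, 58, 54)]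
  base := 1
  x := 54
  hash := 16561061144782
  p := 1
  q := 45
  r := 43
  c := 32
  d := 17

/-- The table of `NC 1`. -/
def table1 : Table where
  H := [16434824, 16405704]
  A := 14498120
  B := 14596176
  R :=
    [16434824, 14498120, 14596176, 14537488, 16303952, 16390864, 16336488, 16358048, 16392936,
    16299360, 14465192, 14504672, 14521640, 14591584, 14570136, 14554456, 14460712, 14599256,
    14469784, 14489832, 16325400, 16425752, 16397416, 16296280, 16341080, 16368296, 16360288,
    16430344, 16427208, 16308432, 16335704, 16333408, 16373896, 16340744, 16422672, 16394840,
    14587104, 14559048, 14533960, 14535248, 14588056, 14472864, 14502600, 14563976, 14562128,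
    14472472, 14522704, 14498400, 14594720, 14570696, 14465808, 14525280, 14537824, 16433872,
    16307872, 16324448, 16362248, 16406096, 16422112, 16296672]
  nb :=
    [(1, 2, 3), (0, 4, 5), (6, 0, 7), (8, 0, 9), (10, 1, 11), (12, 1, 13), (2, 10, 14),
    (15, 2, 16), (3, 12, 17), (18, 3, 19), (4, 6, 20), (21, 4, 22), (5, 8, 23), (24, 5, 25),
    (26, 6, 27), (7, 26, 28), (29, 7, 30), (31, 8, 32), (9, 31, 33), (34, 9, 35),
    (36, 10, 37), (11, 36, 38), (39, 11, 40), (41, 12, 42), (13, 41, 43), (44, 13, 45),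
    (14, 15, 41), (42, 14, 46), (38, 15, 39), (16, 38, 47), (48, 16, 49), (17, 18, 36),
    (37, 17, 50), (43, 18, 44), (19, 43, 51), (52, 19, 49), (20, 21, 31), (32, 20, 53),
    (28, 21, 29), (22, 28, 54), (55, 22, 56), (23, 24, 26), (27, 23, 57), (33, 24, 34),
    (25, 33, 58), (59, 25, 56), (58, 27, 59), (57, 29, 58), (30, 57, 55), (56, 30, 35),
    (54, 32, 55), (53, 34, 54), (35, 53, 59), (51, 37, 52), (50, 39, 51), (40, 50, 48),
    (49, 40, 45), (47, 42, 48), (46, 44, 47), (45, 46, 52)]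
  base := 2
  x := 56
  hash := 17762635347289
  p := 4
  q := 34
  r := 25
  c := 31
  d := 17

/-- The table of `NC 2`. -/
def table2 : Table where
  H := [16434824, 16405704]
  A := 16372496
  B := 14527240
  R :=
    [16434824, 16372496, 16431184, 14527240, 16299360, 14594720, 16358048, 14537824, 14468944,
    14555856, 14473424, 14521640, 14599256, 14587664, 14465192, 14570136, 14504672, 16296672,
    14591584, 16324448, 14498400, 14505736, 14461272, 16423064, 14538888, 16361576, 14525280,
    14592200, 14490392, 16307480, 14595336, 16331560, 16397136, 16336488, 16325400, 16370256,
    16392936, 16296280, 14554792, 16406096, 14562128, 16398984, 16303336, 16362248, 16426592,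
    16430344, 16304792, 16389800, 14468328, 16433872, 14535248, 16368968, 16339680, 16373896,
    16389464, 14559832, 14500696, 14599816, 14460712, 14489832]
  nb :=
    [(1, 2, 3), (4, 0, 5), (6, 0, 7), (8, 9, 0), (6, 1, 10), (11, 12, 1), (4, 2, 13), (14, 15, 2),
    (16, 3, 17), (18, 3, 19), (20, 21, 4), (22, 5, 23), (24, 5, 25), (26, 27, 6), (28, 7, 29),
    (30, 7, 31), (18, 8, 32), (33, 34, 8), (16, 9, 35), (36, 37, 9), (38, 10, 39),
    (40, 10, 41), (24, 11, 42), (43, 44, 11), (22, 12, 45), (46, 47, 12), (48, 13, 49),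
    (50, 13, 51), (30, 14, 47), (43, 52, 14), (28, 15, 53), (54, 42, 15), (47, 51, 16),
    (49, 17, 55), (45, 17, 38), (42, 41, 18), (39, 19, 56), (53, 19, 48), (40, 20, 34),
    (36, 53, 20), (38, 21, 52), (54, 35, 21), (35, 31, 22), (29, 23, 57), (52, 23, 50),
    (34, 49, 24), (51, 25, 58), (32, 25, 28), (50, 26, 37), (33, 45, 26), (48, 27, 44),
    (46, 32, 27), (44, 29, 40), (37, 39, 30), (41, 31, 59), (57, 59, 33), (57, 58, 36),
    (56, 55, 43), (56, 59, 46), (55, 58, 54)]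
  base := 1
  x := 43
  hash := 21301390262906
  p := 4
  q := 25
  r := 29
  c := 9
  d := 16

/-- The table of `NC 3`. -/
def table3 : Table where
  H := [16434824, 16405704]
  A := 14559832
  B := 16362248
  R :=
    [16434824, 14559832, 14500696, 16362248, 16324840, 14501480, 16295720, 14557928, 14588056,
    14472472, 14464352, 16389464, 16296672, 16433872, 14523040, 16304792, 16324448, 16406096,
    16397416, 14521640, 16368296, 14465192, 16372496, 14473424, 14496552, 14563976, 14522704,
    16303952, 14559048, 16360288, 16431184, 14587664, 14526568, 14533960, 14465808, 16390864,
    14502600, 16333408, 14504672, 16341080, 16429728, 16300816, 14591584, 16425752, 16372832,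
    16357712, 14599816, 16368968, 16307872, 14570136, 16430344, 14587104, 14527240, 14472864,
    16398984, 16422112, 14599256, 16373896, 14562128, 14535248]
  nb :=
    [(1, 2, 3), (4, 0, 5), (6, 0, 7), (8, 9, 0), (10, 1, 11), (12, 13, 1), (14, 2, 15),
    (16, 17, 2), (18, 3, 19), (20, 3, 21), (22, 4, 23), (24, 25, 4), (26, 5, 27), (28, 5, 29),
    (30, 6, 31), (32, 33, 6), (34, 7, 35), (36, 7, 37), (38, 8, 39), (40, 41, 8), (42, 9, 43),
    (44, 45, 9), (46, 10, 40), (47, 37, 10), (48, 11, 49), (39, 11, 33), (50, 12, 51),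
    (52, 38, 12), (45, 13, 36), (31, 53, 13), (46, 14, 44), (54, 29, 14), (55, 15, 56),
    (43, 15, 25), (57, 16, 53), (52, 42, 16), (41, 17, 28), (23, 51, 17), (27, 18, 58),
    (53, 25, 18), (56, 19, 22), (36, 19, 48), (35, 20, 59), (51, 33, 20), (49, 21, 30),
    (28, 21, 55), (30, 22, 52), (58, 23, 54), (59, 24, 41), (44, 50, 24), (49, 26, 57),
    (43, 37, 26), (35, 27, 46), (39, 29, 34), (59, 31, 47), (58, 32, 45), (40, 57, 32),
    (56, 34, 50), (47, 55, 38), (54, 48, 42)]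
  base := 1
  x := 3
  hash := 21156114603973
  p := 4
  q := 29
  r := 35
  c := 9
  d := 18

/-- The table of `NC 4`. -/
def table4 : Table where
  H := [16434824, 16433816, 16406152, 16405144]
  A := 16405592
  B := 14522536
  R :=
    [16434824, 16405592, 16406096, 14522536, 14464352, 14465360, 14498400, 14527072, 14525224,
    14496552, 14527240, 14498568, 16336712, 16394056, 16394840, 16337496, 16393832, 16336488,
    16307480, 16307984, 16422168, 16422672, 16423120, 16423064, 16308432, 16308376, 16422112,
    16422560, 16307424, 16307872, 14595168, 14596176, 14537824, 14538832, 14537488, 14537376,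
    14594832, 14594720, 14537992, 14538888, 14595336, 14596232, 14557928, 14559944, 14500584,
    14502600, 14501704, 14559048, 16296728, 16295720, 16325400, 16324392, 16324840, 16296168,
    16357712, 16356704, 16300704, 14570192, 14570696, 14599816]
  nb :=
    [(1, 2, 3), (2, 0, 4), (1, 0, 5), (6, 7, 0), (8, 9, 1), (10, 11, 2), (7, 3, 12), (6, 3, 13),
    (9, 4, 14), (8, 4, 15), (11, 5, 16), (10, 5, 17), (18, 19, 6), (20, 21, 7), (22, 23, 8),
    (24, 25, 9), (26, 27, 10), (28, 29, 11), (19, 12, 30), (18, 12, 31), (21, 13, 32),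
    (20, 13, 33), (23, 14, 34), (22, 14, 35), (25, 15, 36), (24, 15, 37), (27, 16, 38),
    (26, 16, 39), (29, 17, 40), (28, 17, 41), (42, 37, 18), (43, 41, 19), (44, 35, 20),
    (45, 39, 21), (46, 38, 22), (44, 32, 23), (47, 40, 24), (42, 30, 25), (46, 34, 26),
    (45, 33, 27), (47, 36, 28), (43, 31, 29), (37, 30, 48), (41, 31, 49), (35, 32, 50),
    (39, 33, 51), (38, 34, 52), (40, 36, 53), (54, 50, 42), (55, 51, 43), (54, 48, 44),
    (55, 49, 45), (56, 53, 46), (56, 52, 47), (50, 48, 57), (51, 49, 58), (53, 52, 59),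
    (59, 58, 54), (59, 57, 55), (58, 57, 56)]
  base := 8
  x := 56
  hash := 10180735380696
  p := 21
  q := 23
  r := 13
  c := 6
  d := 8

/-- The table of `NC 5`. -/
def table5 : Table where
  H := [16434824, 14598808, 14571144, 16405144]
  A := 16336712
  B := 14465696
  R :=
    [16434824, 16336712, 14559048, 14465696, 14591752, 14498400, 16340744, 16362080, 14464352,
    16300368, 16406152, 16296672, 14595168, 16431184, 14490336, 16372832, 14538832, 16300816,
    16405592, 14464296, 14571088, 14523040, 16307424, 14473424, 16398928, 16307480, 14562408,
    14472976, 14587160, 16422672, 14570192, 16394840, 14502488, 16405704, 14558824, 16336488,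
    14554456, 16389968, 14537488, 16296728, 14469784, 16373000, 14460712, 16303784, 14490392,
    16390808, 16324392, 14554792, 14557928, 16335592, 14506072, 14525224, 16427096, 16331560,
    16362248, 14498568, 14555800, 16389800, 16368296, 14473368]
  nb :=
    [(1, 2, 3), (0, 4, 5), (0, 6, 7), (8, 9, 0), (1, 10, 11), (12, 13, 1), (2, 10, 14),
    (15, 16, 2), (3, 17, 18), (3, 19, 20), (4, 6, 21), (22, 23, 4), (5, 24, 25), (5, 26, 27),
    (26, 24, 6), (7, 23, 28), (7, 22, 29), (8, 21, 30), (31, 32, 8), (9, 21, 33), (34, 35, 9),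
    (19, 17, 10), (11, 16, 36), (11, 15, 37), (12, 14, 38), (39, 40, 12), (13, 14, 41),
    (42, 43, 13), (44, 45, 15), (46, 47, 16), (48, 49, 17), (18, 50, 51), (18, 52, 53),
    (52, 50, 19), (20, 49, 54), (20, 48, 55), (56, 55, 22), (57, 53, 23), (51, 58, 24),
    (25, 59, 48), (25, 54, 47), (54, 59, 26), (27, 58, 52), (27, 51, 45), (28, 56, 49),
    (28, 55, 43), (29, 57, 50), (29, 53, 40), (30, 35, 39), (30, 34, 44), (31, 33, 46),
    (38, 43, 31), (32, 33, 42), (37, 47, 32), (41, 40, 34), (36, 45, 35), (36, 44, 58),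
    (37, 46, 59), (38, 42, 56), (39, 41, 57)]
  base := 12
  x := 3
  hash := 17451784100324
  p := 15
  q := 17
  r := 25
  c := 2
  d := 31

/-- The table of `NC 6`. -/
def table6 : Table where
  H := [16434824, 14598808, 14571144, 16405144]
  A := 16426760
  B := 14523040
  R :=
    [16434824, 16426760, 14505736, 14523040, 14501704, 14527072, 16394056, 16333408, 14523152,
    16356648, 16406152, 16325344, 14535248, 16368744, 14461664, 16398928, 14562408, 16356704,
    16434768, 14522704, 14599256, 14465696, 16390864, 14554344, 16372832, 16422672, 14538832,
    14587160, 14472976, 16307480, 14599368, 16426592, 14505568, 16433872, 14592088, 16341080,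
    14468944, 16303448, 14595336, 16422560, 14489440, 16429840, 14588056, 16324952, 14472864,
    16295776, 16308376, 14461272, 14592200, 16341192, 14501480, 16393832, 14460768, 16307872,
    16296280, 14473368, 14596232, 16333128, 14489384, 16389800]
  nb :=
    [(1, 2, 3), (0, 4, 5), (0, 6, 7), (8, 9, 0), (1, 10, 11), (12, 13, 1), (2, 10, 14),
    (15, 16, 2), (3, 17, 18), (3, 19, 20), (4, 6, 21), (22, 23, 4), (5, 24, 25), (5, 26, 27),
    (26, 24, 6), (7, 23, 28), (7, 22, 29), (8, 21, 30), (31, 32, 8), (9, 21, 33), (34, 35, 9),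
    (19, 17, 10), (11, 16, 36), (11, 15, 37), (12, 14, 38), (39, 40, 12), (13, 14, 41),
    (42, 43, 13), (44, 45, 15), (46, 47, 16), (48, 49, 17), (18, 50, 47), (18, 51, 43),
    (51, 50, 19), (20, 49, 45), (20, 48, 40), (52, 53, 22), (54, 55, 23), (56, 57, 24),
    (25, 58, 55), (25, 59, 35), (59, 58, 26), (27, 57, 53), (27, 56, 32), (28, 52, 56),
    (28, 53, 34), (29, 54, 59), (29, 55, 31), (30, 35, 52), (30, 34, 58), (31, 33, 57),
    (32, 33, 54), (36, 44, 48), (36, 45, 42), (37, 46, 51), (37, 47, 39), (38, 43, 44),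
    (38, 42, 50), (39, 41, 49), (40, 41, 46)]
  base := 12
  x := 21
  hash := 18771197805327
  p := 25
  q := 33
  r := 53
  c := 22
  d := 2

/-- The table of `NC 7`. -/
def table7 : Table where
  H := [16434824, 3842363, 5707744, 9924691]
  A := 8033732
  B := 2207205
  R :=
    [16434824, 8033732, 16188620, 2207205, 12701290, 2908066, 1146061, 3226566, 13702703,
    11603571, 677775, 2780995, 11243939, 9168488, 773465, 7066374, 12401697, 10289902,
    12421514, 13605186, 4056108, 1037428, 10329424, 9407377, 6148198, 5235237, 11513096,
    14527233, 3129518, 1950389, 6771751, 1623279, 8851290, 12107522, 4669693, 5822012,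
    15153936, 16288083, 7925925, 489132, 10005464, 10955203, 4415243, 4646663, 9969323,
    9733815, 2312023, 446355, 12068455, 13938211, 14882973, 6719678, 16274713, 7660856,
    6498940, 15117340, 7881594, 16040346, 5781965, 5568710, 8599017, 8844528, 3701460,
    1359316, 10711778, 13021666, 15830185, 5135809, 11641406, 947030, 13751752, 13504141,
    3273074, 3025463, 15603112, 5349253, 11427962, 1174103, 6639080, 15260896, 10842398,
    8958334, 12934852, 342391]
  nb :=
    [(1, 2, 3), (2, 0, 4), (1, 0, 5), (6, 7, 0), (8, 9, 1), (10, 11, 2), (7, 3, 12), (6, 3, 13),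
    (9, 4, 14), (8, 4, 15), (11, 5, 16), (10, 5, 17), (18, 19, 6), (20, 21, 7), (22, 23, 8),
    (24, 25, 9), (26, 27, 10), (28, 29, 11), (19, 12, 30), (18, 12, 31), (21, 13, 32),
    (20, 13, 33), (23, 14, 34), (22, 14, 35), (25, 15, 36), (24, 15, 37), (27, 16, 38),
    (26, 16, 39), (29, 17, 40), (28, 17, 41), (42, 43, 18), (44, 45, 19), (46, 47, 20),
    (48, 49, 21), (50, 51, 22), (52, 53, 23), (54, 55, 24), (56, 57, 25), (58, 59, 26),
    (60, 61, 27), (62, 63, 28), (64, 65, 29), (43, 30, 58), (42, 30, 66), (45, 31, 50),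
    (44, 31, 67), (47, 32, 62), (46, 32, 68), (49, 33, 54), (48, 33, 69), (51, 34, 44),
    (50, 34, 70), (53, 35, 60), (52, 35, 71), (55, 36, 48), (54, 36, 72), (57, 37, 64),
    (56, 37, 73), (59, 38, 42), (58, 38, 74), (61, 39, 52), (60, 39, 75), (63, 40, 46),
    (62, 40, 76), (65, 41, 56), (64, 41, 77), (78, 73, 43), (79, 77, 45), (80, 71, 47),
    (81, 75, 49), (82, 76, 51), (80, 68, 53), (83, 74, 55), (78, 66, 57), (83, 72, 59),
    (81, 69, 61), (82, 70, 63), (79, 67, 65), (73, 66, 80), (77, 67, 81), (71, 68, 78),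
    (75, 69, 79), (76, 70, 83), (74, 72, 82)]
  base := 8
  x := 3
  hash := 23060501927913
  p := 17
  q := 21
  r := 68
  c := 2
  d := 4

/-- The table of `NC 8`. -/
def table8 : Table where
  H := [16434824, 6565685, 11243939, 1174103]
  A := 1907612
  B := 10289902
  R :=
    [16434824, 1907612, 5781965, 10289902, 8599017, 13751752, 8327466, 2312023, 7066374, 1808149,
    15117340, 13504141, 10729558, 9116359, 7576240, 12288668, 3025463, 10238578, 12130552,
    880425, 9781128, 14969066, 5264119, 5902687, 1037428, 2249982, 6047657, 1659875, 7660856,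
    3273074, 1250683, 6148198, 2839004, 6538637, 947030, 4646663, 14465192, 16357922, 9710841,
    11603571, 12721107, 7537621, 14527233, 11140164, 2815526, 10538171, 8895621, 11476500,
    12757199, 15338078, 8103977, 11513096, 3803114, 9733815, 12864159, 7696948, 14799764,
    15896790, 10278275, 2780995, 736869, 4319609, 9392824, 13267177, 3942750, 1359316,
    2908066, 1449714, 4708760, 15819608, 16330860, 9200975, 1146061, 3790983, 13021666,
    8627059, 4987710, 6852524, 12534872, 16147985, 502502, 15486037, 11743375, 13279000]
  nb :=
    [(1, 2, 3), (4, 0, 5), (4, 0, 6), (7, 8, 0), (2, 1, 9), (10, 11, 1), (12, 13, 2), (14, 3, 15),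
    (14, 3, 16), (17, 18, 4), (19, 5, 20), (19, 5, 21), (22, 6, 23), (22, 6, 24), (8, 7, 25),
    (26, 27, 7), (28, 29, 8), (25, 9, 30), (25, 9, 31), (11, 10, 22), (32, 33, 10),
    (34, 35, 11), (13, 12, 19), (36, 37, 12), (38, 39, 13), (18, 17, 14), (40, 15, 41),
    (40, 15, 42), (43, 16, 44), (43, 16, 45), (46, 47, 17), (48, 49, 18), (50, 20, 51),
    (50, 20, 52), (53, 21, 54), (53, 21, 55), (56, 23, 57), (56, 23, 58), (59, 24, 60),
    (59, 24, 61), (27, 26, 43), (57, 62, 26), (51, 63, 27), (29, 28, 40), (60, 64, 28),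
    (54, 65, 29), (66, 30, 67), (66, 30, 68), (69, 31, 70), (69, 31, 71), (33, 32, 53),
    (42, 72, 32), (67, 73, 33), (35, 34, 50), (45, 74, 34), (70, 75, 35), (37, 36, 59),
    (41, 76, 36), (71, 77, 37), (39, 38, 56), (44, 78, 38), (68, 79, 39), (76, 41, 80),
    (72, 42, 81), (78, 44, 82), (74, 45, 83), (47, 46, 69), (52, 81, 46), (61, 82, 47),
    (49, 48, 66), (55, 83, 48), (58, 80, 49), (63, 51, 76), (81, 52, 79), (65, 54, 78),
    (83, 55, 77), (62, 57, 72), (80, 58, 75), (64, 60, 74), (82, 61, 73), (71, 77, 62),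
    (67, 73, 63), (68, 79, 64), (70, 75, 65)]
  base := 10
  x := 3
  hash := 35280318845036
  p := 14
  q := 53
  r := 78
  c := 21
  d := 28

/-! ### ### Verification of the nine tables -/

theorem valid0 : table0.Valid where
  nodup := by decide +kernel
  pos := by decide +kernel
  rep_zero := by decide +kernel
  length_nb := by decide +kernel
  reach := by decide +kernel
  out := by decide +kernel
  nbrs_spec := by decide +kernel
  base_lt := by decide +kernel
  pair_nodup := by decide +kernel
  point_spec := by decide +kernel
  x_lt := by decide +kernel
  semiregular := by decide +kernel
  lt := by decide +kernel
  p_ne := by decide +kernel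
  conj_q := by decide +kernel
  conj_r := by decide +kernel
  commutator := by decide +kernel

theorem models0 : table0.Models row0 where
  code_a := by decide +kernel
  code_b := by decide +kernel
  mem_H := mem_codes_involution (by decide +kernel) (by decide +kernel)
  card_le := card_S5.le

theorem valid1 : table1.Valid where
  nodup := by decide +kernel
  pos := by decide +kernel
  rep_zero := by decide +kernel
  length_nb := by decide +kernel
  reach := by decide +kernel
  out := by decide +kernel
  nbrs_spec := by decide +kernel
  base_lt := by decide +kernel
  pair_nodup := by decide +kernel
  point_spec := by decide +kernel
  x_lt := by decide +kernel
  semiregular := by decide +kernel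
  lt := by decide +kernel
  p_ne := by decide +kernel
  conj_q := by decide +kernel
  conj_r := by decide +kernel
  commutator := by decide +kernel

theorem models1 : table1.Models row1 where
  code_a := by decide +kernel
  code_b := by decide +kernel
  mem_H := mem_codes_involution (by decide +kernel) (by decide +kernel)
  card_le := card_A5Z2_le

theorem valid2 : table2.Valid where
  nodup := by decide +kernel
  pos := by decide +kernel
  rep_zero := by decide +kernel
  length_nb := by decide +kernel
  reach := by decide +kernel
  out := by decide +kernel
  nbrs_spec := by decide +kernel
  base_lt := by decide +kernel
  pair_nodup := by decide +kernel
  point_spec := by decide +kernel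
  x_lt := by decide +kernel
  semiregular := by decide +kernel
  lt := by decide +kernel
  p_ne := by decide +kernel
  conj_q := by decide +kernel
  conj_r := by decide +kernel
  commutator := by decide +kernel

theorem models2 : table2.Models row2 where
  code_a := by decide +kernel
  code_b := by decide +kernel
  mem_H := mem_codes_involution (by decide +kernel) (by decide +kernel)
  card_le := card_A5Z2_le

theorem valid3 : table3.Valid where
  nodup := by decide +kernel
  pos := by decide +kernel
  rep_zero := by decide +kernel
  length_nb := by decide +kernel
  reach := by decide +kernel
  out := by decide +kernel
  nbrs_spec := by decide +kernel
  base_lt := by decide +kernel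
  pair_nodup := by decide +kernel
  point_spec := by decide +kernel
  x_lt := by decide +kernel
  semiregular := by decide +kernel
  lt := by decide +kernel
  p_ne := by decide +kernel
  conj_q := by decide +kernel
  conj_r := by decide +kernel
  commutator := by decide +kernel

theorem models3 : table3.Models row3 where
  code_a := by decide +kernel
  code_b := by decide +kernel
  mem_H := mem_codes_involution (by decide +kernel) (by decide +kernel)
  card_le := card_A5Z2_le

theorem valid4 : table4.Valid where
  nodup := by decide +kernel
  pos := by decide +kernel
  rep_zero := by decide +kernel
  length_nb := by decide +kernel
  reach := by decide +kernel
  out := by decide +kernel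
  nbrs_spec := by decide +kernel
  base_lt := by decide +kernel
  pair_nodup := by decide +kernel
  point_spec := by decide +kernel
  x_lt := by decide +kernel
  semiregular := by decide +kernel
  lt := by decide +kernel
  p_ne := by decide +kernel
  conj_q := by decide +kernel
  conj_r := by decide +kernel
  commutator := by decide +kernel

theorem models4 : table4.Models row4 where
  code_a := by decide +kernel
  code_b := by decide +kernel
  mem_H := mem_codes_four_group (by decide +kernel) (by decide +kernel)
  card_le := card_S5Z2_le

theorem valid5 : table5.Valid where
  nodup := by decide +kernel
  pos := by decide +kernel
  rep_zero := by decide +kernel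
  length_nb := by decide +kernel
  reach := by decide +kernel
  out := by decide +kernel
  nbrs_spec := by decide +kernel
  base_lt := by decide +kernel
  pair_nodup := by decide +kernel
  point_spec := by decide +kernel
  x_lt := by decide +kernel
  semiregular := by decide +kernel
  lt := by decide +kernel
  p_ne := by decide +kernel
  conj_q := by decide +kernel
  conj_r := by decide +kernel
  commutator := by decide +kernel

theorem models5 : table5.Models row5 where
  code_a := by decide +kernel
  code_b := by decide +kernel
  mem_H := mem_codes_four_group (by decide +kernel) (by decide +kernel)
  card_le := card_S5Z2_le

theorem valid6 : table6.Valid where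
  nodup := by decide +kernel
  pos := by decide +kernel
  rep_zero := by decide +kernel
  length_nb := by decide +kernel
  reach := by decide +kernel
  out := by decide +kernel
  nbrs_spec := by decide +kernel
  base_lt := by decide +kernel
  pair_nodup := by decide +kernel
  point_spec := by decide +kernel
  x_lt := by decide +kernel
  semiregular := by decide +kernel
  lt := by decide +kernel
  p_ne := by decide +kernel
  conj_q := by decide +kernel
  conj_r := by decide +kernel
  commutator := by decide +kernel

theorem models6 : table6.Models row6 where
  code_a := by decide +kernel
  code_b := by decide +kernel
  mem_H := mem_codes_four_group (by decide +kernel) (by decide +kernel)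
  card_le := card_S5Z2_le

theorem valid7 : table7.Valid where
  nodup := by decide +kernel
  pos := by decide +kernel
  rep_zero := by decide +kernel
  length_nb := by decide +kernel
  reach := by decide +kernel
  out := by decide +kernel
  nbrs_spec := by decide +kernel
  base_lt := by decide +kernel
  pair_nodup := by decide +kernel
  point_spec := by decide +kernel
  x_lt := by decide +kernel
  semiregular := by decide +kernel
  lt := by decide +kernel
  p_ne := by decide +kernel
  conj_q := by decide +kernel
  conj_r := by decide +kernel
  commutator := by decide +kernel

theorem models7 : table7.Models row7 where
  code_a := by decide +kernel
  code_b := by decide +kernel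
  mem_H := mem_codes_four_group (by decide +kernel) (by decide +kernel)
  card_le := card_PGL27_le

theorem valid8 : table8.Valid where
  nodup := by decide +kernel
  pos := by decide +kernel
  rep_zero := by decide +kernel
  length_nb := by decide +kernel
  reach := by decide +kernel
  out := by decide +kernel
  nbrs_spec := by decide +kernel
  base_lt := by decide +kernel
  pair_nodup := by decide +kernel
  point_spec := by decide +kernel
  x_lt := by decide +kernel
  semiregular := by decide +kernel
  lt := by decide +kernel
  p_ne := by decide +kernel
  conj_q := by decide +kernel
  conj_r := by decide +kernel
  commutator := by decide +kernel

theorem models8 : table8.Models row8 where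
  code_a := by decide +kernel
  code_b := by decide +kernel
  mem_H := mem_codes_four_group (by decide +kernel) (by decide +kernel)
  card_le := card_PGL27_le

/-- The tables of the nine graphs. -/
def table : Fin 9 → Table :=
  ![table0, table1, table2, table3, table4, table5, table6, table7, table8]

theorem valid_table (i : Fin 9) : (table i).Valid := by
  fin_cases i
  exacts [valid0, valid1, valid2, valid3, valid4, valid5, valid6, valid7, valid8]

theorem models_row (i : Fin 9) : (table i).Models (row i) := by
  fin_cases i
  exacts [models0, models1, models2, models3, models4, models5, models6, models7, models8]

end CubicVNC

/-! ### ### The nine graphs together -/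

theorem theorem4p1 :
    (∀ i : Fin 9,
      Nat.card (CubicVNC.row i).Vertex = (if i ≤ 6 then 60 else 84) ∧
      CubicVNC.IsCubic (CubicVNC.NC i) ∧
      CubicVNC.IsVNC (CubicVNC.NC i) ∧
      ¬ CubicVNC.IsArcTransitive (CubicVNC.NC i) ∧
      ¬ Group.IsSolvable (CubicVNC.NC i ≃g CubicVNC.NC i)) ∧
    ∀ i j : Fin 9, i ≠ j → IsEmpty (CubicVNC.NC i ≃g CubicVNC.NC j) := by
  have main := fun i => CubicVNC.Table.main (CubicVNC.valid_table i) (CubicVNC.models_row i)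
  refine ⟨fun i => ?_, fun i j hij => ⟨fun f => hij ?_⟩⟩
  · obtain ⟨hc, h3, hV, hA, hS, -⟩ := main i
    have hn : ∀ i, (CubicVNC.table i).n = if i ≤ 6 then 60 else 84 := by decide +kernel
    exact ⟨hc.trans (hn i), h3, hV, hA, hS⟩
  -- The invariant is the same at every vertex, so an isomorphism can be tested at any one vertex
  -- and its image.
  · have hinj : Function.Injective fun i => (CubicVNC.table i).hash := by decide +kernel
    let v : (CubicVNC.row i).Vertex := Quotient.mk _ 1
    refine hinj ?_
    exact ((main i).2.2.2.2.2 v).symm.trans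
      ((CubicVNC.pointHash_iso f 10 v).symm.trans ((main j).2.2.2.2.2 (f v)))
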